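/- Let $F_0$ be a complete discretely valued field with ring of integers $O_{F_0}$ and perfect residue field of characteristic $\neq 2$. Let $F/F_0$ be a ramified quadratic extension with ring of integers $O_F$, and let $\pi\in F$ be a uniformizer such that $\pi^2=\pi_0$ is a uniformizer of $F_0$; put $k=O_F/\pi$. Let $n=2m>3$, and let $n=r+s$ with $0\le s\le r$. Let $V=F^n$ with standard basis $e_1,\dots,e_n$ carry the split $F/F_0$-hermitian form $\phi$ with $\phi(e_i,e_{n+1-j})=\delta_{ij}$ and the symmetric $F_0$-bilinear form $(x,y)=\frac12\mathrm{Tr}_{F/F_0}\phi(x,y)$, and let $$\Lambda_m=\mathrm{span}_{O_F}\{\pi^{-1}e_1,\dots,\pi^{-1}e_m,e_{m+1},\dots,e_n\},$$ on which $(\cdot,\cdot)$ is a perfect $O_{F_0}$-valued pairing. Write $t$ for multiplication by $\pi$ on $\Lambda_m$, extended $R$-linearly to $\Lambda_m\otimes_{O_{F_0}}R$ for every $O_F$-algebra $R$, and $\pi$ for the scalar multiplication by the image of $\pi$ in $R$. Let $\mathrm M^{\mathrm{spl}}$ be the moduli space over $O_F$ whose $R$-valued points are the pairs $(\mathcal F,\mathcal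 G)$ of Zariski locally direct summands of $\Lambda_m\otimes_{O_{F_0}}R$, of ranks $n$ and $s$, such that $\mathcal G\subset\mathcal F$; $\mathcal F$ is totally isotropic for $(\cdot,\cdot)$, i.e. $\mathcal F=\mathcal F^{\perp}$; $(t+\pi)\mathcal F\subset\mathcal G$ and $(t-\pi)\mathcal G=0$; and (spin condition) at every point of $\mathrm{Spec}\,R$ the rank of $t+\pi$ on $\mathcal F$ has the same parity as $s$. For such a point let $\mathcal G^{\perp'}=(t-\pi)\mathcal G^{\perp}$, the orthogonal of $\mathcal G$ under the modified pairing $\{(t+\pi)x,(t-\pi)y\}=((t+\pi)x,y)$. For integers $h,l$ let $X_{h,l}$ be the set of points $x=(\mathcal F,\mathcal G)$ of the special fiber $\mathrm M^{\mathrm{spl}}\otimes_{O_F}k$ such that, over the residue field of $x$, $\dim t\mathcal F=h$ and $\dim(\mathcal G\cap\mathcal G^{\perp'})=l$. Proposition. Let $0\le h\le l\le s$ with $h\equiv l\equiv s \pmod 2$. Then the closure of $X_{h,l}$ in $\mathrm M^{\mathrm{spl}}\otimes_{O_F}k$ is the disjoint union $$\overline{X_{h,l}}=\coprod_{\substack{0\le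 h'\le h\le l\le l'\le s\\ h'\equiv l'\equiv s\ (\mathrm{mod}\ 2)}}X_{h',l'}.$$ -/

import Mathlib

open CategoryTheory AlgebraicGeometry TensorProduct
open scoped Module.Grassmannian

universe u

noncomputable section

/-! ## The split hermitian space and its standard lattices -/

section Lattice

/-- `F / F₀` is a ramified quadratic extension of the fraction field `F₀` of the discrete valuation
ring `A = O_{F₀}`, with ring of integers `B = O_F` and uniformizers `π`, `π₀` such that `π² = π₀`;
`σ` is the nontrivial automorphism, and the residue characteristic is not two. -/
structure IsRamifiedQuadratic (A B F₀ F : Type u) [CommRing A] [IsDomain A]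
    [IsDiscreteValuationRing A] [CommRing B] [Field F₀] [Field F]
    [Algebra A F₀] [IsFractionRing A F₀] [Algebra F₀ F] [Algebra A F] [IsScalarTower A F₀ F]
    [Algebra A B] [Algebra B F] [IsScalarTower A B F] [IsIntegralClosure B A F]
    (σ : F ≃ₐ[F₀] F) (π₀ : A) (π : B) : Prop where
  residue_char : ringChar (IsLocalRing.ResidueField A) ≠ 2
  finrank_eq : Module.finrank F₀ F = 2
  conj_ne_one : σ ≠ 1
  irreducible_base : Irreducible π₀
  irreducible : Irreducible π
  sq_eq : π ^ 2 = algebraMap A B π₀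

variable {A B F₀ F : Type u} [CommRing A] [IsDomain A]
    [IsDiscreteValuationRing A] [CommRing B] [Field F₀] [Field F]
    [Algebra A F₀] [IsFractionRing A F₀] [Algebra F₀ F] [Algebra A F] [IsScalarTower A F₀ F]
    [Algebra A B] [Algebra B F] [IsScalarTower A B F] [IsIntegralClosure B A F]

/-- The split `F / F₀`-hermitian form on `V = Fⁿ`: conjugate-linear in the first variable, with
`φ (e_i) (e_{n+1-j}) = δ_{ij}` for the standard basis `e_1, …, e_n`. -/
def splitHermitian (σ : F ≃ₐ[F₀] F) {n : ℕ} (x y : Fin n → F) : F :=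
  ∑ i, σ (x i) * y (Fin.rev i)

/-- The symmetric `F₀`-bilinear form `(x, y) = ½ Tr_{F/F₀} (φ (x, y))`. -/
def traceForm (σ : F ≃ₐ[F₀] F) (n : ℕ) : LinearMap.BilinForm F₀ (Fin n → F) :=
  LinearMap.mk₂ F₀ (fun x y => (1 / 2 : F₀) * Algebra.trace F₀ F (splitHermitian σ x y))
    (fun x x' y => by
      simp [splitHermitian, add_mul, Finset.sum_add_distrib, mul_add])
    (fun c x y => by
      have : splitHermitian σ (c • x) y = c • splitHermitian σ x y := by
        simp [splitHermitian, Finset.smul_sum]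
      rw [this, map_smul, smul_eq_mul, smul_eq_mul]; ring)
    (fun x y y' => by
      simp [splitHermitian, mul_add, Finset.sum_add_distrib])
    (fun c x y => by
      have : splitHermitian σ x (c • y) = c • splitHermitian σ x y := by
        simp [splitHermitian, Finset.smul_sum]
      rw [this, map_smul, smul_eq_mul, smul_eq_mul]; ring)

/-- The standard lattice
`Λ_i = span_{O_F} {π⁻¹ e_1, …, π⁻¹ e_i, e_{i+1}, …, e_n}` in `V = Fⁿ`. -/
def stdLattice (F : Type u) {B : Type u} [CommRing B] [Field F] [Algebra B F] (π : B) (n i : ℕ) :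
    Submodule B (Fin n → F) :=
  Submodule.span B (Set.range fun j : Fin n =>
    if (j : ℕ) < i then (algebraMap B F π)⁻¹ • (Pi.single j 1 : Fin n → F) else Pi.single j 1)

lemma mem_stdLattice_coord {π : B} {n i : ℕ} {x : Fin n → F}
    (hx : x ∈ stdLattice F π n i) (j : Fin n) :
    ∃ b : B, algebraMap B F b = (if (j : ℕ) < i then algebraMap B F π else 1) * x j := by
  unfold stdLattice at hx
  by_cases hπ : algebraMap B F π = 0
  · by_cases hj : (j : ℕ) < i
    · exact ⟨0, by simp [hj, hπ]⟩
    simp only [hj, if_false, one_mul]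
    induction hx using Submodule.span_induction with
    | mem y hy =>
      obtain ⟨l, rfl⟩ := hy
      by_cases hl : (l : ℕ) < i
      · exact ⟨0, by simp [hl, hπ]⟩
      · by_cases hjl : j = l
        · exact ⟨1, by subst hjl; simp [hl]⟩
        · exact ⟨0, by simp [hl, hjl]⟩
    | zero => exact ⟨0, by simp⟩
    | add y z _ _ h1 h2 =>
      obtain ⟨a, ha⟩ := h1; obtain ⟨b, hb⟩ := h2
      exact ⟨a + b, by simp [ha, hb]⟩
    | smul c y _ h =>
      obtain ⟨a, ha⟩ := h
      exact ⟨c * a, by simp [ha, Algebra.smul_def]⟩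
  · induction hx using Submodule.span_induction with
    | mem y hy =>
      obtain ⟨l, rfl⟩ := hy
      by_cases hjl : j = l
      · subst hjl
        refine ⟨1, ?_⟩
        by_cases hj : (j : ℕ) < i <;> simp [hj, hπ]
      · refine ⟨0, ?_⟩
        by_cases hl : (l : ℕ) < i <;> simp [hl, hjl]
    | zero => exact ⟨0, by simp⟩
    | add y z _ _ h1 h2 =>
      obtain ⟨a, ha⟩ := h1; obtain ⟨b, hb⟩ := h2
      exact ⟨a + b, by simp [ha, hb, mul_add]⟩
    | smul c y _ h =>
      obtain ⟨a, ha⟩ := h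
      exact ⟨c * a, by simp [ha, Algebra.smul_def, mul_left_comm]⟩

lemma exists_algebraMap_conj (A : Type u) {B F₀ F : Type u} [CommRing A] [CommRing B] [Field F₀]
    [Field F] [Algebra A F₀] [Algebra F₀ F] [Algebra A F] [IsScalarTower A F₀ F]
    [Algebra A B] [Algebra B F] [IsScalarTower A B F] [IsIntegralClosure B A F]
    (σ : F ≃ₐ[F₀] F) (b : B) : ∃ c : B, algebraMap B F c = σ (algebraMap B F b) := by
  rw [← IsIntegralClosure.isIntegral_iff (R := A) (A := B) (B := F)]
  have h : IsIntegral A (algebraMap B F b) :=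
    (IsIntegralClosure.isIntegral_iff (R := A) (A := B) (B := F)).2 ⟨b, rfl⟩
  exact h.map ((σ : F →ₐ[F₀] F).restrictScalars A)

lemma exists_algebraMap_trace {σ : F ≃ₐ[F₀] F} {π₀ : A} {π : B}
    (h : IsRamifiedQuadratic A B F₀ F σ π₀ π) (b : B) :
    ∃ a : A, algebraMap A F₀ a =
      (1 / 2 : F₀) * Algebra.trace F₀ F ((algebraMap B F π)⁻¹ * algebraMap B F b) := by
  have hfin : FiniteDimensional F₀ F := .of_finrank_pos (by rw [h.finrank_eq]; norm_num)
  have hcard : Fintype.card (F ≃ₐ[F₀] F) = 2 := by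
    refine le_antisymm ?_ ?_
    · exact (AlgEquiv.card_le (F := F₀) (K := F)).trans_eq h.finrank_eq
    · exact Fintype.one_lt_card_iff.2 ⟨σ, 1, h.conj_ne_one⟩
  have hgal : IsGalois F₀ F := IsGalois.of_card_aut_eq_finrank _ _ (by
    rw [Nat.card_eq_fintype_card, hcard, h.finrank_eq])
  have htr : ∀ x : F, algebraMap F₀ F (Algebra.trace F₀ F x) = x + σ x := by
    intro x
    classical
    rw [trace_eq_sum_automorphisms]
    have : (Finset.univ : Finset (F ≃ₐ[F₀] F)) = {1, σ} := by
      symm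
      apply Finset.eq_univ_of_card
      rw [Finset.card_pair h.conj_ne_one.symm, hcard]
    rw [this, Finset.sum_pair h.conj_ne_one.symm]
    rfl
  have hinjB : Function.Injective (algebraMap B F) := IsIntegralClosure.algebraMap_injective B A F
  have hinjA : Function.Injective (algebraMap A F₀) := IsFractionRing.injective A F₀
  have hinjAF : Function.Injective (algebraMap A F) := by
    rw [IsScalarTower.algebraMap_eq A F₀ F]
    exact (algebraMap F₀ F).injective.comp hinjA
  have hπ : algebraMap B F π ≠ 0 := fun h0 => h.irreducible.ne_zero (hinjB (by simpa using h0))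
  have hsq : (algebraMap B F π) ^ 2 = algebraMap A F π₀ := by
    rw [← map_pow, h.sq_eq, ← IsScalarTower.algebraMap_apply]
  have hσ : σ (algebraMap B F π) = algebraMap B F π ∨ σ (algebraMap B F π) = -algebraMap B F π := by
    rw [← sq_eq_sq_iff_eq_or_eq_neg, ← map_pow, hsq, IsScalarTower.algebraMap_apply A F₀ F,
      σ.commutes]
  -- the trace of `π b` is integral and divisible by `π`, hence by `π₀`
  obtain ⟨b', hb'⟩ := exists_algebraMap_conj A σ b
  have hint : IsIntegral A (algebraMap B F (π * b)) :=
    (IsIntegralClosure.isIntegral_iff (R := A) (A := B) (B := F)).2 ⟨π * b, rfl⟩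
  obtain ⟨a, ha⟩ := (IsIntegrallyClosed.isIntegral_iff (R := A) (K := F₀)).1
    (Algebra.isIntegral_trace (R := A) (L := F₀) (F := F) hint)
  have hdvd : π ∣ algebraMap A B a := by
    have e : algebraMap B F (algebraMap A B a) = algebraMap B F (π * b) + σ (algebraMap B F (π * b)) := by
      rw [← IsScalarTower.algebraMap_apply, IsScalarTower.algebraMap_apply A F₀ F, ha, htr]
    rcases hσ with hσ | hσ
    · refine ⟨b + b', hinjB ?_⟩
      rw [e]; simp only [map_mul, map_add, hσ, ← hb']; ring
    · refine ⟨b - b', hinjB ?_⟩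
      rw [e]; simp only [map_mul, map_sub, hσ, ← hb']; ring
  have hnu : ¬ IsUnit a := fun hu =>
    h.irreducible.not_isUnit (isUnit_of_dvd_unit hdvd (hu.map (algebraMap A B)))
  have hmem : a ∈ IsLocalRing.maximalIdeal A := hnu
  rw [h.irreducible_base.maximalIdeal_eq, Ideal.mem_span_singleton] at hmem
  obtain ⟨c, rfl⟩ := hmem
  have h2 : IsUnit (2 : A) := by
    rw [← IsLocalRing.residue_ne_zero_iff_isUnit, map_ofNat]
    exact Ring.two_ne_zero h.residue_char
  obtain ⟨d, hd⟩ := h2.exists_right_inv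
  have hdF : (1 / 2 : F₀) = algebraMap A F₀ d := by
    have : (2 : F₀) * algebraMap A F₀ d = 1 := by
      rw [← map_ofNat (algebraMap A F₀) 2, ← map_mul, hd, map_one]
    rw [one_div]
    exact inv_eq_of_mul_eq_one_right this
  refine ⟨d * c, ?_⟩
  rw [map_mul, hdF]
  congr 1
  have hπ0 : algebraMap A F₀ π₀ ≠ 0 := fun h0 =>
    h.irreducible_base.ne_zero (hinjA (by simpa using h0))
  apply mul_left_cancel₀ hπ0
  rw [← map_mul, ha, ← smul_eq_mul (algebraMap A F₀ π₀), ← map_smul, Algebra.smul_def,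
    ← IsScalarTower.algebraMap_apply, ← hsq, map_mul]
  congr 1
  field_simp

lemma exists_algebraMap_traceForm {σ : F ≃ₐ[F₀] F} {π₀ : A} {π : B}
    (h : IsRamifiedQuadratic A B F₀ F σ π₀ π) (m : ℕ) {x y : Fin (2 * m) → F}
    (hx : x ∈ stdLattice F π (2 * m) m) (hy : y ∈ stdLattice F π (2 * m) m) :
    ∃ a : A, algebraMap A F₀ a = traceForm σ (2 * m) x y := by
  have hfin : FiniteDimensional F₀ F := .of_finrank_pos (by rw [h.finrank_eq]; norm_num)
  have hinjB : Function.Injective (algebraMap B F) := IsIntegralClosure.algebraMap_injective B A F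
  have hπ : algebraMap B F π ≠ 0 := fun h0 => h.irreducible.ne_zero (hinjB (by simpa using h0))
  have key : ∀ i, ∃ a : A, algebraMap A F₀ a =
      (1 / 2 : F₀) * Algebra.trace F₀ F (σ (x i) * y (Fin.rev i)) := by
    intro i
    obtain ⟨b, hb⟩ := mem_stdLattice_coord hx i
    obtain ⟨c, hc⟩ := mem_stdLattice_coord hy (Fin.rev i)
    by_cases hi : (i : ℕ) < m
    · have hi' : ¬ ((Fin.rev i : Fin (2 * m)) : ℕ) < m := by rw [Fin.val_rev]; omega
      rw [if_pos hi] at hb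
      rw [if_neg hi', one_mul] at hc
      obtain ⟨c', hc'⟩ := exists_algebraMap_conj A σ.symm c
      obtain ⟨a, ha⟩ := exists_algebraMap_trace h (b * c')
      refine ⟨a, ha.trans ?_⟩
      congr 1
      rw [← Algebra.trace_eq_of_algEquiv (σ : F ≃ₐ[F₀] F)]
      congr 1
      rw [map_mul (algebraMap B F), hc', hb, mul_assoc, inv_mul_cancel_left₀ hπ, map_mul,
        AlgEquiv.apply_symm_apply, hc]
    · have hi' : ((Fin.rev i : Fin (2 * m)) : ℕ) < m := by rw [Fin.val_rev]; omega
      rw [if_neg hi, one_mul] at hb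
      rw [if_pos hi'] at hc
      obtain ⟨b', hb'⟩ := exists_algebraMap_conj A σ b
      obtain ⟨a, ha⟩ := exists_algebraMap_trace h (c * b')
      refine ⟨a, ha.trans ?_⟩
      rw [map_mul (algebraMap B F), hb', hc, mul_assoc, inv_mul_cancel_left₀ hπ, hb, mul_comm (y _)]
  choose a ha using key
  refine ⟨∑ i, a i, ?_⟩
  simp only [traceForm, LinearMap.mk₂_apply, splitHermitian, map_sum, Finset.mul_sum, ha]

/-- The perfect symmetric `O_{F₀}`-bilinear pairing `(·, ·) : Λ_m × Λ_m → O_{F₀}` on the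
self-dual lattice `Λ_m`, `n = 2m`, obtained by restricting `½ Tr_{F/F₀} φ`. -/
def latticeForm {σ : F ≃ₐ[F₀] F} {π₀ : A} {π : B}
    (h : IsRamifiedQuadratic A B F₀ F σ π₀ π) (m : ℕ) :
    LinearMap.BilinForm A (stdLattice F π (2 * m) m) :=
  LinearMap.restrictScalarsRange₂ (R := F₀) (S := A)
    ((stdLattice F π (2 * m) m).subtype.restrictScalars A)
    ((stdLattice F π (2 * m) m).subtype.restrictScalars A)
    (Algebra.linearMap A F₀) (IsFractionRing.injective A F₀) (traceForm σ (2 * m))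
    (fun x y => exists_algebraMap_traceForm h m x.2 y.2)

/-- Multiplication by the uniformizer `π` on `Λ_m`, as an `O_{F₀}`-linear map. -/
def latticeT (A : Type u) {B F : Type u} [CommRing A] [CommRing B] [Field F] [Algebra A F]
    [Algebra A B] [Algebra B F] [IsScalarTower A B F] (π : B) (m : ℕ) :
    stdLattice F π (2 * m) m →ₗ[A] stdLattice F π (2 * m) m :=
  (LinearMap.lsmul B (stdLattice F π (2 * m) m) π).restrictScalars A

end Lattice

/-! ## The splitting moduli problem -/

section Moduli

variable {C : Type u} [CommRing C] {L : Type u} [AddCommGroup L] [Module C L]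

/-- The operator `t + c` on `R ⊗ L`, for an endomorphism `t` of `L` and a scalar `c`. -/
def shiftOp (t : L →ₗ[C] L) (c : C) (R : Type u) [CommRing R] [Algebra C R] :
    R ⊗[C] L →ₗ[R] R ⊗[C] L :=
  t.baseChange R + algebraMap C R c • LinearMap.id

/-- The conditions on a point `(F, G)` of the splitting model with values in a `C`-algebra `R`.
Here `F` and `G` are submodules of `R ⊗ L` with locally free quotients of rank `n` and `n + r`
(i.e. direct summands of rank `n` and `s` when `L` is free of rank `2 n = n + r + s`). -/
structure IsSplittingPair (t : L →ₗ[C] L) (b : LinearMap.BilinForm C L) (ϖ : C) (n r s : ℕ)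
    {R : Type u} [CommRing R] [Algebra C R]
    (F : G(n, (R ⊗[C] L); R)) (G : G(n + r, (R ⊗[C] L); R)) : Prop where
  /-- `G ⊆ F` -/
  le : G.toSubmodule ≤ F.toSubmodule
  /-- `F` is totally isotropic (equivalently `F = F^⊥`, for a perfect form on a free module of
  rank `2 n`) -/
  isotropic : ∀ x ∈ F.toSubmodule, ∀ y ∈ F.toSubmodule, b.baseChange R x y = 0
  /-- `(t + ϖ) F ⊆ G` -/
  map_add_le : F.toSubmodule.map (shiftOp t ϖ R) ≤ G.toSubmodule
  /-- `(t - ϖ) G = 0` -/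
  map_sub_eq_bot : G.toSubmodule.map (shiftOp t (-ϖ) R) = ⊥
  /-- spin condition: at every point of `Spec R`, the rank of `t + ϖ` on `F` is congruent to `s`
  modulo two -/
  spin : ∀ p : PrimeSpectrum R,
    Module.finrank p.asIdeal.ResidueField
      ((Module.Grassmannian.map (IsScalarTower.toAlgHom C R p.asIdeal.ResidueField)
        F).toSubmodule.map (shiftOp t ϖ p.asIdeal.ResidueField)) ≡ s [MOD 2]

lemma span_rTensor_eq_map {R S : Type u} [CommRing R] [Algebra C R] [CommRing S] [Algebra C S]
    [Algebra R S] [IsScalarTower C R S] (N : Submodule R (R ⊗[C] L)) :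
    Submodule.span S ((IsScalarTower.toAlgHom C R S).toLinearMap.rTensor L '' N) =
      (N.baseChange S).map
        (AlgebraTensorModule.cancelBaseChange C R S S L).toLinearMap := by
  have h : ∀ x : R ⊗[C] L, AlgebraTensorModule.cancelBaseChange C R S S L (1 ⊗ₜ x) =
      (IsScalarTower.toAlgHom C R S).toLinearMap.rTensor L x := by
    intro x
    induction x with
    | zero => simp
    | add x y hx hy => rw [tmul_add, map_add, hx, hy, map_add]
    | tmul a l => simp [Algebra.smul_def]
  rw [Submodule.baseChange_eq_span, Submodule.map_span]
  congr 1
  ext y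
  simp only [Set.mem_image, SetLike.mem_coe, Submodule.mem_map, exists_exists_and_eq_and,
    TensorProduct.mk_apply, LinearEquiv.coe_coe, h]

lemma ker_baseChangeMkQ {R S : Type u} [CommRing R] [Algebra C R] [CommRing S] [Algebra C S]
    [Algebra R S] [IsScalarTower C R S] (N : Submodule R (R ⊗[C] L)) :
    (Module.Grassmannian.baseChangeMkQ S N).ker =
      Submodule.span S ((IsScalarTower.toAlgHom C R S).toLinearMap.rTensor L '' N) := by
  have h1 : LinearMap.ker (N.mkQ.baseChange S) = N.baseChange S := by
    have h2 := lTensor_mkQ (Q := S) N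
    ext x
    rw [LinearMap.mem_ker]
    exact SetLike.ext_iff.1 h2 x
  rw [span_rTensor_eq_map, ← h1, Submodule.map_equiv_eq_comap_symm]
  rfl

lemma grassmannian_map_toSubmodule {k : ℕ} {R S : Type u} [CommRing R] [Algebra C R] [CommRing S]
    [Algebra C S] (f : R →ₐ[C] S) (N : G(k, (R ⊗[C] L); R)) :
    (Module.Grassmannian.map f N).toSubmodule =
      Submodule.span S (f.toLinearMap.rTensor L '' N.toSubmodule) := by
  let : Algebra R S := f.toAlgebra
  have : IsScalarTower C R S := IsScalarTower.of_algebraMap_eq' f.comp_algebraMap.symm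
  exact (Module.Grassmannian.map_toSubmodule f N).trans (ker_baseChangeMkQ N.toSubmodule)

lemma shiftOp_rTensor (t : L →ₗ[C] L) (c : C) {R S : Type u} [CommRing R] [Algebra C R] [CommRing S]
    [Algebra C S] (f : R →ₐ[C] S) (x : R ⊗[C] L) :
    shiftOp t c S (f.toLinearMap.rTensor L x) = f.toLinearMap.rTensor L (shiftOp t c R x) := by
  induction x with
  | zero => simp
  | add x y hx hy => simp only [map_add, hx, hy]
  | tmul a l => simp [shiftOp, TensorProduct.smul_tmul', ]

lemma baseChange_form_rTensor (b : LinearMap.BilinForm C L) {R S : Type u} [CommRing R]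
    [Algebra C R] [CommRing S] [Algebra C S] (f : R →ₐ[C] S) (x y : R ⊗[C] L) :
    b.baseChange S (f.toLinearMap.rTensor L x) (f.toLinearMap.rTensor L y) =
      f (b.baseChange R x y) := by
  induction x with
  | zero => simp
  | add x x' hx hx' => simp only [map_add, LinearMap.add_apply, hx, hx']
  | tmul a l =>
    induction y with
    | zero => simp
    | add y y' hy hy' => simp only [map_add, hy, hy']
    | tmul a' l' => simp

lemma map_shiftOp_span (t : L →ₗ[C] L) (c : C) {R S : Type u} [CommRing R] [Algebra C R]
    [CommRing S] [Algebra C S] (f : R →ₐ[C] S) (N : Submodule R (R ⊗[C] L)) :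
    (Submodule.span S (f.toLinearMap.rTensor L '' N)).map (shiftOp t c S) =
      Submodule.span S (f.toLinearMap.rTensor L '' (N.map (shiftOp t c R))) := by
  rw [Submodule.map_span]
  congr 1
  ext x
  simp only [Set.mem_image, SetLike.mem_coe, Submodule.mem_map]
  constructor
  · rintro ⟨_, ⟨y, hy, rfl⟩, rfl⟩
    exact ⟨_, ⟨y, hy, rfl⟩, (shiftOp_rTensor t c f y).symm⟩
  · rintro ⟨_, ⟨y, hy, rfl⟩, rfl⟩
    exact ⟨_, ⟨y, hy, rfl⟩, shiftOp_rTensor t c f y⟩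

lemma finrank_span_rTensor {K E : Type u} [Field K] [Field E] [Algebra C K] [Algebra C E]
    (f : K →ₐ[C] E) (N : Submodule K (K ⊗[C] L)) :
    Module.finrank E (Submodule.span E (f.toLinearMap.rTensor L '' N)) = Module.finrank K N := by
  let : Algebra K E := f.toAlgebra
  have : IsScalarTower C K E := IsScalarTower.of_algebraMap_eq' f.comp_algebraMap.symm
  have hf : f = IsScalarTower.toAlgHom C K E := rfl
  have : Module.Free K N := Module.Free.of_divisionRing K N
  rw [hf, span_rTensor_eq_map, LinearEquiv.finrank_map_eq,
    ← (Submodule.toBaseChange.toLinearEquiv E N).finrank_eq, Module.finrank_baseChange]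

lemma IsSplittingPair.map {t : L →ₗ[C] L} {b : LinearMap.BilinForm C L} {ϖ : C} {n r s : ℕ}
    {R S : Type u} [CommRing R] [Algebra C R] [CommRing S] [Algebra C S]
    {F : G(n, (R ⊗[C] L); R)} {G : G(n + r, (R ⊗[C] L); R)}
    (h : IsSplittingPair t b ϖ n r s F G) (f : R →ₐ[C] S) :
    IsSplittingPair t b ϖ n r s (Module.Grassmannian.map f F) (Module.Grassmannian.map f G) where
  le := by
    rw [grassmannian_map_toSubmodule, grassmannian_map_toSubmodule]
    exact Submodule.span_mono (Set.image_mono h.le)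
  isotropic := by
    intro x hx y hy
    rw [grassmannian_map_toSubmodule] at hx hy
    induction hx using Submodule.span_induction with
    | zero => simp
    | add x x' _ _ hx hx' => simp only [map_add, LinearMap.add_apply, hx, hx', add_zero]
    | smul c x _ hx => simp only [map_smul, LinearMap.smul_apply, hx, smul_zero]
    | mem x hx =>
      obtain ⟨x, hx, rfl⟩ := hx
      induction hy using Submodule.span_induction with
      | zero => simp
      | add y y' _ _ hy hy' => simp only [map_add, hy, hy', add_zero]
      | smul c y _ hy => simp only [map_smul, hy, smul_zero]
      | mem y hy =>
        obtain ⟨y, hy, rfl⟩ := hy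
        rw [baseChange_form_rTensor, h.isotropic x hx y hy, map_zero]
  map_add_le := by
    rw [grassmannian_map_toSubmodule, grassmannian_map_toSubmodule, map_shiftOp_span]
    exact Submodule.span_mono (Set.image_mono h.map_add_le)
  map_sub_eq_bot := by
    rw [grassmannian_map_toSubmodule, map_shiftOp_span, h.map_sub_eq_bot]
    simp
  spin := by
    intro q
    let p : PrimeSpectrum R := PrimeSpectrum.comap f.toRingHom q
    let g : p.asIdeal.ResidueField →ₐ[C] q.asIdeal.ResidueField :=
      Ideal.ResidueField.mapₐ p.asIdeal q.asIdeal f rfl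
    have hg : (IsScalarTower.toAlgHom C S q.asIdeal.ResidueField).comp f =
        g.comp (IsScalarTower.toAlgHom C R p.asIdeal.ResidueField) := by
      ext x
      exact (Ideal.ResidueField.map_algebraMap p.asIdeal q.asIdeal f.toRingHom rfl x).symm
    rw [← Module.Grassmannian.map_comp, hg, Module.Grassmannian.map_comp,
      grassmannian_map_toSubmodule g, map_shiftOp_span, finrank_span_rTensor]
    exact h.spin p

/-- The splitting moduli functor: it sends a `C`-algebra `R` to the set of pairs `(F, G)` as in
`IsSplittingPair`, and an algebra map to base change along it. -/
def splittingFunctor (t : L →ₗ[C] L) (b : LinearMap.BilinForm C L) (ϖ : C) (n r s : ℕ) :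
    CommAlgCat.{u} C ⥤ Type u where
  obj R := {P : G(n, (R ⊗[C] L); R) × G(n + r, (R ⊗[C] L); R) //
    IsSplittingPair t b ϖ n r s P.1 P.2}
  map f := ↾fun P => ⟨(Module.Grassmannian.map f.hom P.1.1, Module.Grassmannian.map f.hom P.1.2),
    P.2.map f.hom⟩
  map_id R := by
    refine ConcreteCategory.hom_ext _ _ fun P => Subtype.ext ?_
    exact Prod.ext (Module.Grassmannian.map_id _ R P.1.1) (Module.Grassmannian.map_id _ R P.1.2)
  map_comp f g := by
    refine ConcreteCategory.hom_ext _ _ fun P => Subtype.ext ?_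
    exact Prod.ext (Module.Grassmannian.map_comp _ f.hom g.hom P.1.1)
      (Module.Grassmannian.map_comp _ f.hom g.hom P.1.2)

end Moduli

/-! ## The topological space of a functor of points

For a functor `M` on commutative `C`-algebras, the underlying space `|M|` consists of the
equivalence classes of points of `M` with values in fields; a subset is open when its preimage
under every `Spec R → |M|` given by an `R`-valued point is open. When `M` is the functor of points
of a scheme `X`, this is the underlying topological space of `X`, as `homeomorph` below shows. -/

section PointSpace

variable {C : Type u} [CommRing C]

/-- A point of the functor `M` with values in a field. -/
structure FieldPoint (M : CommAlgCat.{u} C ⥤ Type u) where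
  /-- the field -/
  K : Type u
  [field : Field K]
  [algebra : Algebra C K]
  /-- the `K`-valued point -/
  pt : M.obj (CommAlgCat.of C K)

attribute [instance] FieldPoint.field FieldPoint.algebra

/-- The underlying space of `M`: field-valued points, where a point is identified with its images
under field extensions. -/
def PointSpace (M : CommAlgCat.{u} C ⥤ Type u) : Type (u + 1) :=
  Quot fun x y : FieldPoint M =>
    ∃ f : x.K →ₐ[C] y.K, M.map (CommAlgCat.ofHom f) x.pt = y.pt

namespace PointSpace

variable {M : CommAlgCat.{u} C ⥤ Type u}

/-- The point of `|M|` under a field-valued point. -/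
def mk (x : FieldPoint M) : PointSpace M := Quot.mk _ x

/-- The map `Spec R → |M|` defined by an `R`-valued point of `M`. -/
def ofPoint {R : Type u} [CommRing R] [Algebra C R] (ξ : M.obj (CommAlgCat.of C R))
    (p : PrimeSpectrum R) : PointSpace M :=
  mk ⟨p.asIdeal.ResidueField,
    M.map (CommAlgCat.ofHom (IsScalarTower.toAlgHom C R p.asIdeal.ResidueField)) ξ⟩

instance : TopologicalSpace (PointSpace M) where
  IsOpen U := ∀ (R : Type u) [CommRing R] [Algebra C R] (ξ : M.obj (CommAlgCat.of C R)),
    IsOpen (ofPoint ξ ⁻¹' U)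
  isOpen_univ _ _ _ _ := isOpen_univ
  isOpen_inter _ _ hU hV R _ _ ξ := (hU R ξ).inter (hV R ξ)
  isOpen_sUnion S hS R _ _ ξ := by
    rw [Set.preimage_sUnion]
    exact isOpen_biUnion fun U hU => hS U hU R ξ

lemma isOpen_iff {U : Set (PointSpace M)} : IsOpen U ↔
    ∀ (R : Type u) [CommRing R] [Algebra C R] (ξ : M.obj (CommAlgCat.of C R)),
      IsOpen (ofPoint ξ ⁻¹' U) := Iff.rfl

/-- The image in a scheme of the unique point of the spectrum of a field. -/
def _root_.AlgebraicGeometry.Scheme.Hom.imagePoint {X : Scheme.{u}} {K : Type u} [Field K]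
    (f : Spec (.of K) ⟶ X) : X :=
  f.base (IsLocalRing.closedPoint K : PrimeSpectrum K)

lemma imagePoint_comp {X : Scheme.{u}} {R K : Type u} [CommRing R] [Field K]
    (g : R →+* K) (f : Spec (.of R) ⟶ X) :
    (Spec.map (CommRingCat.ofHom g) ≫ f).imagePoint =
      f.base (PrimeSpectrum.comap g (IsLocalRing.closedPoint K)) := rfl

/-- `M` is the functor of points of the scheme `p : X ⟶ Spec C`. -/
structure SchemeRepresentation (M : CommAlgCat.{u} C ⥤ Type u) {X : Scheme.{u}}
    (p : X ⟶ Spec (.of C)) where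
  /-- the bijection between `M (R)` and `X (R)` -/
  equiv (R : Type u) [CommRing R] [Algebra C R] : M.obj (CommAlgCat.of C R) ≃
    {f : Spec (.of R) ⟶ X // f ≫ p = Spec.map (CommRingCat.ofHom (algebraMap C R))}
  /-- naturality -/
  equiv_map {R S : Type u} [CommRing R] [Algebra C R] [CommRing S] [Algebra C S]
    (g : R →ₐ[C] S) (ξ : M.obj (CommAlgCat.of C R)) :
    (equiv S (M.map (CommAlgCat.ofHom g) ξ)).1 =
      Spec.map (CommRingCat.ofHom g.toRingHom) ≫ (equiv R ξ).1

namespace SchemeRepresentation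

variable {X : Scheme.{u}} {p : X ⟶ Spec (.of C)} (e : SchemeRepresentation M p)

/-- The comparison map `|M| → X`. -/
def toScheme : PointSpace M → X :=
  Quot.lift (fun x => (e.equiv x.K x.pt).1.imagePoint) (by
    rintro x y ⟨f, hf⟩
    have h := e.equiv_map f x.pt
    rw [hf] at h
    refine Eq.trans ?_ (congrArg Scheme.Hom.imagePoint h.symm)
    rw [imagePoint_comp]
    exact congrArg (e.equiv x.K x.pt).1.base (Subsingleton.elim (α := PrimeSpectrum x.K) _ _))

lemma toScheme_ofPoint {R : Type u} [CommRing R] [Algebra C R] (ξ : M.obj (CommAlgCat.of C R))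
    (q : PrimeSpectrum R) : e.toScheme (ofPoint ξ q) = (e.equiv R ξ).1.base q := by
  have h := e.equiv_map (IsScalarTower.toAlgHom C R q.asIdeal.ResidueField) ξ
  refine (congrArg Scheme.Hom.imagePoint h).trans ?_
  rw [imagePoint_comp]
  refine congrArg (e.equiv R ξ).1.base (PrimeSpectrum.ext ?_)
  ext x
  change algebraMap R q.asIdeal.ResidueField x ∈ IsLocalRing.maximalIdeal _ ↔ _
  rw [IsLocalRing.maximalIdeal_eq_bot, Ideal.mem_bot, Ideal.algebraMap_residueField_eq_zero]

lemma toScheme_surjective : Function.Surjective e.toScheme := by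
  intro x
  let f := X.fromSpecResidueField x
  let i := Spec.preimage (f ≫ p)
  let : Algebra C (X.residueField x) := i.hom.toAlgebra
  have hf : f ≫ p = Spec.map (CommRingCat.ofHom (algebraMap C (X.residueField x))) :=
    (Spec.map_preimage (f ≫ p)).symm
  refine ⟨PointSpace.mk ⟨X.residueField x, (e.equiv (X.residueField x)).symm ⟨f, hf⟩⟩, ?_⟩
  change ((e.equiv (X.residueField x)) _).1.imagePoint = x
  rw [Equiv.apply_symm_apply]
  exact X.fromSpecResidueField_apply x _

lemma exists_factor {K : Type u} [Field K] (f : Spec (.of K) ⟶ X) {x : X}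
    (hx : f.imagePoint = x) :
    ∃ g : X.residueField x ⟶ .of K, Spec.map g ≫ X.fromSpecResidueField x = f := by
  subst hx
  exact ⟨_, X.descResidueField_stalkClosedPointTo_fromSpecResidueField K f⟩

lemma mk_eq (y : FieldPoint M) {x : X} (hx : (e.equiv y.K y.pt).1.imagePoint = x)
    [Algebra C (X.residueField x)]
    (hf : X.fromSpecResidueField x ≫ p =
      Spec.map (CommRingCat.ofHom (algebraMap C (X.residueField x)))) :
    PointSpace.mk y = PointSpace.mk ⟨X.residueField x,
      (e.equiv (X.residueField x)).symm ⟨X.fromSpecResidueField x, hf⟩⟩ := by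
  symm
  obtain ⟨g, hg⟩ := exists_factor _ hx
  have hc : CommRingCat.ofHom (algebraMap C (X.residueField x)) ≫ g =
      CommRingCat.ofHom (algebraMap C y.K) := by
    apply Spec.map_injective
    rw [Spec.map_comp, ← hf, ← Category.assoc, hg]
    exact (e.equiv y.K y.pt).2
  let g' : X.residueField x →ₐ[C] y.K :=
    { g.hom with commutes' := fun c => congrArg (fun k => k.hom c) hc }
  refine Quot.sound ⟨g', ?_⟩
  apply (e.equiv y.K).injective
  apply Subtype.ext
  refine (e.equiv_map g' _).trans ?_
  simp only [Equiv.apply_symm_apply]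
  exact hg

lemma toScheme_injective : Function.Injective e.toScheme := by
  rintro ⟨y⟩ ⟨z⟩ h
  let x : X := (e.equiv y.K y.pt).1.imagePoint
  let f := X.fromSpecResidueField x
  let i := Spec.preimage (f ≫ p)
  let : Algebra C (X.residueField x) := i.hom.toAlgebra
  have hf : f ≫ p = Spec.map (CommRingCat.ofHom (algebraMap C (X.residueField x))) :=
    (Spec.map_preimage (f ≫ p)).symm
  exact (e.mk_eq y (x := x) rfl hf).trans (e.mk_eq z (x := x) h.symm hf).symm

/-- If `M` is the functor of points of a scheme `X`, then `|M|` is homeomorphic to the underlying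
topological space of `X`. -/
def homeomorph : PointSpace M ≃ₜ X :=
  (Equiv.ofBijective e.toScheme ⟨e.toScheme_injective, e.toScheme_surjective⟩).toHomeomorph (by
    intro U
    change IsOpen (e.toScheme ⁻¹' U) ↔ _
    constructor
    · intro h
      rw [isOpen_iff_forall_mem_open]
      intro x hx
      let j := X.affineCover.f (X.affineCover.idx x)
      obtain ⟨q, hq⟩ := X.affineCover.covers x
      let R : CommRingCat.{u} := X.affineOpenCover.X (X.affineCover.idx x)
      let i := Spec.preimage (R := CommRingCat.of C) (S := R) (j ≫ p)
      let : Algebra C R := i.hom.toAlgebra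
      have hf : j ≫ p = Spec.map (CommRingCat.ofHom (algebraMap C R)) :=
        (Spec.map_preimage (R := CommRingCat.of C) (S := R) (j ≫ p)).symm
      have h1 := h R ((e.equiv R).symm ⟨j, hf⟩)
      rw [← Set.preimage_comp] at h1
      have h2 : e.toScheme ∘ ofPoint ((e.equiv R).symm ⟨j, hf⟩) = j.base := by
        funext q
        rw [Function.comp_apply, toScheme_ofPoint, Equiv.apply_symm_apply]
        rfl
      rw [h2] at h1
      refine ⟨j.base '' (j.base ⁻¹' U), Set.image_preimage_subset _ _,
        j.isOpenEmbedding.isOpenMap _ h1, ⟨q, ?_, hq⟩⟩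
      change j.base q ∈ U
      exact hq.symm ▸ hx
    · intro h R _ _ ξ
      rw [← Set.preimage_comp]
      have h2 : e.toScheme ∘ ofPoint ξ = (e.equiv R ξ).1.base := by
        funext q
        rw [Function.comp_apply, toScheme_ofPoint]
      rw [h2]
      exact h.preimage (e.equiv R ξ).1.continuous)

end SchemeRepresentation

end PointSpace

end PointSpace

/-! ## The splitting model and its strata -/

section Strata

/-- The dimension of `t F` at a field-valued point `(F, G)`. -/
def hInvariant {C L : Type u} [CommRing C] [AddCommGroup L] [Module C L] {t : L →ₗ[C] L}
    {b : LinearMap.BilinForm C L} {ϖ : C} {n r s : ℕ}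
    (x : FieldPoint (splittingFunctor t b ϖ n r s)) : ℕ :=
  Module.finrank x.K (x.pt.1.1.toSubmodule.map (t.baseChange x.K))

/-- The dual `G^{⊥'} ⊆ (t - ϖ) (R ⊗ L)` of `G ⊆ (t + ϖ) (R ⊗ L)` under the modified pairing
`{(t + ϖ) x, (t - ϖ) y} = ((t + ϖ) x, y)`: it consists of the `(t - ϖ) y` with `(g, y) = 0` for
all `g ∈ G`, so `G^{⊥'} = (t - ϖ) G^⊥`. -/
def modifiedPerp {C L : Type u} [CommRing C] [AddCommGroup L] [Module C L] (t : L →ₗ[C] L)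
    (b : LinearMap.BilinForm C L) (ϖ : C) {R : Type u} [CommRing R] [Algebra C R]
    (G : Submodule R (R ⊗[C] L)) : Submodule R (R ⊗[C] L) :=
  ((b.baseChange R).orthogonal G).map (shiftOp t (-ϖ) R)

/-- The dimension of `G ∩ G^{⊥'}` at a field-valued point `(F, G)`. -/
def lInvariant {C L : Type u} [CommRing C] [AddCommGroup L] [Module C L] {t : L →ₗ[C] L}
    {b : LinearMap.BilinForm C L} {ϖ : C} {n r s : ℕ}
    (x : FieldPoint (splittingFunctor t b ϖ n r s)) : ℕ :=
  Module.finrank x.K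
    (x.pt.1.2.toSubmodule ⊓ modifiedPerp t b ϖ x.pt.1.2.toSubmodule : Submodule x.K _)

variable {A B F₀ F : Type u} [CommRing A] [IsDomain A]
    [IsDiscreteValuationRing A] [CommRing B] [Field F₀] [Field F]
    [Algebra A F₀] [IsFractionRing A F₀] [Algebra F₀ F] [Algebra A F] [IsScalarTower A F₀ F]
    [Algebra A B] [Algebra B F] [IsScalarTower A B F] [IsIntegralClosure B A F]
    {σ : F ≃ₐ[F₀] F} {π₀ : A} {π : B}

/-- The splitting model `M^spl` over `O_F`, as a functor on `O_F`-algebras: pairs `G ⊆ F` of direct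
summands of `Λ_m ⊗_{O_{F₀}} R = R ⊗_{O_F} (O_F ⊗_{O_{F₀}} Λ_m)` of ranks `s` and `n = 2m = r + s`,
with `F` totally isotropic, `(t + π) F ⊆ G`, `(t - π) G = 0`, and the spin condition. -/
def splittingModel (D : IsRamifiedQuadratic A B F₀ F σ π₀ π) (m r s : ℕ) :
    CommAlgCat.{u} B ⥤ Type u :=
  splittingFunctor (C := B) (L := B ⊗[A] stdLattice F π (2 * m) m)
    ((latticeT A π m).baseChange B) ((latticeForm D m).baseChange B) π (2 * m) r s

/-- The underlying space of the special fiber `M^spl ⊗ k` (`k = O_F / π`): the fiber of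
`|M^spl| → |Spec O_F|` over the closed point, with the subspace topology. -/
def specialFiber (D : IsRamifiedQuadratic A B F₀ F σ π₀ π) (m r s : ℕ) :
    Set (PointSpace (splittingModel D m r s)) :=
  {P | ∃ x : FieldPoint (splittingModel D m r s),
    PointSpace.mk x = P ∧ algebraMap B x.K π = 0}

/-- The stratum `X_{h,l}` of the special fiber: the points `(F, G)` with `dim t F = h` and
`dim (G ∩ G^{⊥'}) = l`. -/
def stratum (D : IsRamifiedQuadratic A B F₀ F σ π₀ π) (m r s h l : ℕ) :
    Set (specialFiber D m r s) :=
  {P | ∃ x : FieldPoint (splittingModel D m r s),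
    PointSpace.mk x = P.1 ∧ hInvariant x = h ∧ lInvariant x = l}

end Strata

end

/-! ## Linear algebra of a module with a square-zero skew operator -/

/-! Over a field `K` in which `π` vanishes, `V = Λ_m ⊗ K` has a perfect symmetric form and a skew
operator `t` with `t² = 0` and `ker t = im t`. A point is a Lagrangian `F` with `tF ⊆ G ⊆ F` and `tG
= 0`. The modified pairing `{tx, ty} = (tx, y)` is alternating on `ker t`, and `N = G ∩ G^{⊥'}` is
the radical of its restriction to `G`. Since `F ⊆ G^⊥`, the space `tF` lies in `N`. An alternating
form has even rank, so `l ≡ s`; the spin condition says `h ≡ s`.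

The closure is contained in the union because `dim tF ≤ h` and `dim N ≥ l` are closed conditions.
Both bound the rank of a pairing of submodules that commute with base change, namely `tF × V` and `G
× t⁻¹(G)`, so they are given by the vanishing of minors (`finrank_add_le_iff_exists_det`,
`isClosed_region`).

Conversely, when `dim tF + 2 ≤ dim N`, two vectors of `N` independent modulo `tF` yield two
deformations over the affline line `Spec K[X]`, whose fibre at `X = 0` is the given point. One fixes
`G` and moves `F` by an isometric shear along isotropic vectors `u, v ∈ G^⊥` with `tu, tv ∈ N`; at
the generic point `tF` gains `tu, tv`, so `h` rises by two. The other fixes `F` and shears `G`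
inside `F`, which adds to the alternating form on `G` a rank two form that is nondegenerate on a
plane of `N`, so `l` drops by two. See `IsDualLattice.finrank_raise` and
`IsDualLattice.finrank_lower`. Every point of `X_{h',l'}` thus specializes from `X_{h'+2,l'}` and
from `X_{h',l'-2}` as long as `h' + 2 ≤ l'`, and iterating reaches `X_{h,l}` (`mem_closure_strata`).
The families start from a point over an arbitrary field, so neither normal forms nor algebraically
closed fields are needed. -/

/-- The properties shared by all base changes of a lattice with a perfect symmetric pairing `b`
and a `b`-skew operator `t` with `t² = c`. -/
structure IsDualLattice {R V : Type*} [CommRing R] [AddCommGroup V] [Module R V]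
    (t : V →ₗ[R] V) (b : LinearMap.BilinForm R V) (c : R) (d : ℕ) : Prop where
  symm : ∀ x y, b x y = b y x
  skew : ∀ x y, b (t x) y = -b x (t y)
  sq : ∀ x, t (t x) = c • x
  homotopy : ∃ j : V →ₗ[R] V, ∀ x, t (j x) + j (t x) = x
  dual : ∃ (β : Module.Basis (Fin d) R V) (γ : Fin d → V),
    ∀ i k, b (β i) (γ k) = if i = k then 1 else 0

/-- The conditions of the special fiber on a pair of submodules. -/
structure IsSpecialPair {R V : Type*} [CommRing R] [AddCommGroup V] [Module R V]
    (t : V →ₗ[R] V) (b : LinearMap.BilinForm R V) (F G : Submodule R V) : Prop where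
  le : G ≤ F
  isotropic : ∀ x ∈ F, ∀ y ∈ F, b x y = 0
  map_le : ∀ x ∈ F, t x ∈ G
  map_eq_zero : ∀ x ∈ G, t x = 0

/-! ### Shear automorphisms and the pairs they produce. -/

section Transvection

variable {R V : Type*} [CommRing R] [AddCommGroup V] [Module R V]

/-- The map `z ↦ z + τ (b(p, z) q - b(p', z) q')`. -/
def biShear (b : LinearMap.BilinForm R V) (p q p' q' : V) (τ : R) : V →ₗ[R] V :=
  LinearMap.id + τ • ((b p).smulRight q - (b p').smulRight q')

lemma biShear_apply (b : LinearMap.BilinForm R V) (p q p' q' : V) (τ : R) (z : V) :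
    biShear b p q p' q' τ z = z + τ • (b p z • q - b p' z • q') := rfl

/-- Since both linear forms vanish on both vectors, the added operator has square zero, so the
parameter `-τ` undoes `τ`. -/
lemma biShear_comp_neg {b : LinearMap.BilinForm R V} {p q p' q' : V} (h₁ : b p q = 0)
    (h₂ : b p q' = 0) (h₃ : b p' q = 0) (h₄ : b p' q' = 0) (τ : R) (z : V) :
    biShear b p q p' q' τ (biShear b p q p' q' (-τ) z) = z := by
  simp only [biShear_apply, map_add, map_smul, map_sub, h₁, h₂, h₃, h₄]
  simp

/-- The map `biShear` as an automorphism, when its linear forms vanish on its vectors. -/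
def biShearEquiv {b : LinearMap.BilinForm R V} {p q p' q' : V} (h₁ : b p q = 0)
    (h₂ : b p q' = 0) (h₃ : b p' q = 0) (h₄ : b p' q' = 0) (τ : R) : V ≃ₗ[R] V :=
  LinearEquiv.ofLinearMap (biShear b p q p' q' τ) (biShear b p q p' q' (-τ))
    (LinearMap.ext fun z => biShear_comp_neg h₁ h₂ h₃ h₄ τ z)
    (LinearMap.ext fun z => by simpa using biShear_comp_neg h₁ h₂ h₃ h₄ (-τ) z)

lemma biShear_zero (b : LinearMap.BilinForm R V) (p q p' q' : V) :
    biShear b p q p' q' 0 = LinearMap.id := by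
  ext z; simp [biShear_apply]

/-- Vectors along which `dim t F` can be raised by two. -/
structure IsRaising (t : V →ₗ[R] V) (b : LinearMap.BilinForm R V) (F G : Submodule R V)
    (u v z z' : V) : Prop where
  u_perp : ∀ g ∈ G, b u g = 0
  v_perp : ∀ g ∈ G, b v g = 0
  tu_mem : t u ∈ G
  tv_mem : t v ∈ G
  uu : b u u = 0
  uv : b u v = 0
  vv : b v v = 0
  z_mem : z ∈ F
  z'_mem : z' ∈ F
  tz : t z = 0
  tz' : t z' = 0
  uz : b u z = 1
  uz' : b u z' = 0
  vz : b v z = 0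
  vz' : b v z' = 1

/-- Vectors along which `dim (G ∩ G^{⊥'})` can be lowered by two. -/
structure IsLowering (t : V →ₗ[R] V) (b : LinearMap.BilinForm R V) (F G : Submodule R V)
    (w w' a a' : V) : Prop where
  tw_mem : t w ∈ F
  tw'_mem : t w' ∈ F
  w_perp : ∀ x ∈ F, b w (t x) = 0
  w'_perp : ∀ x ∈ F, b w' (t x) = 0
  wtw : b w (t w) = 0
  wtw' : b w (t w') = 0
  w'tw : b w' (t w) = 0
  w'tw' : b w' (t w') = 0
  a_mem : a ∈ G
  a'_mem : a' ∈ G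
  a_perp : ∀ x, t x ∈ G → b a x = 0
  a'_perp : ∀ x, t x ∈ G → b a' x = 0
  wa : b w a = 1
  wa' : b w a' = 0
  w'a : b w' a = 0
  w'a' : b w' a' = 1

variable {t : V →ₗ[R] V} {b : LinearMap.BilinForm R V} {F G : Submodule R V}

/-- The shear `x ↦ x + τ (b(v, x) u - b(u, x) v)` is an isometry because `u, v` are isotropic and
mutually orthogonal. It fixes `G`, which is orthogonal to `u` and `v`, and it alters `tF` only by
multiples of `tu, tv ∈ G`. -/
lemma IsSpecialPair.raise (h : IsSpecialPair t b F G) (hs : ∀ x y, b x y = b y x) {u v z z' : V}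
    (hr : IsRaising t b F G u v z z') (τ : R) :
    IsSpecialPair t b (F.map (biShear b v u u v τ)) G where
  le g hg := ⟨g, h.le hg, by
    simp [biShear_apply, hr.u_perp g hg, hr.v_perp g hg]⟩
  isotropic := by
    rintro _ ⟨x, hx, rfl⟩ _ ⟨y, hy, rfl⟩
    simp only [biShear_apply, map_add, map_smul, map_sub, LinearMap.add_apply, LinearMap.smul_apply,
      LinearMap.sub_apply, smul_eq_mul, h.isotropic x hx y hy, hr.uu, hr.uv, hr.vv, hs v u, hs x u,
      hs x v]
    ring
  map_le := by
    rintro _ ⟨x, hx, rfl⟩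
    simp only [biShear_apply, map_add, map_smul, map_sub]
    exact G.add_mem (h.map_le x hx) (G.smul_mem _ (G.sub_mem (G.smul_mem _ hr.tu_mem)
      (G.smul_mem _ hr.tv_mem)))
  map_eq_zero := h.map_eq_zero

/-- The shear moves `G` by multiples of `tw, tw' ∈ F`, which `t` kills, and it fixes `tF` because
`w, w'` are orthogonal to `tF`. -/
lemma IsSpecialPair.lower (h : IsSpecialPair t b F G) (ht : ∀ x, t (t x) = 0) {w w' a a' : V}
    (hr : IsLowering t b F G w w' a a') (τ : R) :
    IsSpecialPair t b F (G.map (biShear b w (t w') w' (t w) τ)) where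
  le := by
    rintro _ ⟨x, hx, rfl⟩
    exact F.add_mem (h.le hx) (F.smul_mem _ (F.sub_mem (F.smul_mem _ hr.tw'_mem)
      (F.smul_mem _ hr.tw_mem)))
  isotropic := h.isotropic
  map_le x hx := ⟨t x, h.map_le x hx, by
    simp [biShear_apply, hr.w_perp x hx, hr.w'_perp x hx]⟩
  map_eq_zero := by
    rintro _ ⟨x, hx, rfl⟩
    simp [biShear_apply, h.map_eq_zero x hx, ht]

end Transvection

/-! ### Over a field: existence of the deformations and their effect on the two dimensions. -/

section Field

variable {K V : Type*} [Field K] [AddCommGroup V] [Module K V]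
  {t : V →ₗ[K] V} {b : LinearMap.BilinForm K V} {F G : Submodule K V} {d : ℕ}

namespace IsDualLattice

variable {R V : Type*} [CommRing R] [AddCommGroup V] [Module R V]
  {t : V →ₗ[R] V} {b : LinearMap.BilinForm R V} {d : ℕ} {c : R}

lemma eq_zero (H : IsDualLattice t b c d) {x : V} (hx : ∀ y, b x y = 0) : x = 0 := by
  obtain ⟨β, γ, h⟩ := H.dual
  apply β.repr.injective
  ext k
  have := hx (γ k)
  rw [← β.sum_repr x] at this
  simp only [map_sum, map_smul, LinearMap.sum_apply, LinearMap.smul_apply, h, smul_eq_mul,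
    mul_ite, mul_one, mul_zero, Finset.sum_ite_eq', Finset.mem_univ, if_true] at this
  simpa using this

lemma exists_of_map_eq_zero (H : IsDualLattice t b c d) {x : V} (hx : t x = 0) :
    ∃ y, t y = x := by
  obtain ⟨j, hj⟩ := H.homotopy
  exact ⟨j x, by simpa [hx] using hj x⟩

end IsDualLattice

variable (H : IsDualLattice t b 0 d)
include H

lemma IsDualLattice.finiteDimensional : FiniteDimensional K V := by
  obtain ⟨β, γ, h⟩ := H.dual
  exact β.finiteDimensional_of_finite

lemma IsDualLattice.finrank_eq : Module.finrank K V = d := by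
  obtain ⟨β, γ, h⟩ := H.dual
  simp [Module.finrank_eq_nat_card_basis β]

lemma IsDualLattice.nondegenerate : b.Nondegenerate :=
  ⟨fun _ hx => H.eq_zero hx, fun _ hx => H.eq_zero fun y => (H.symm _ _).trans (hx y)⟩

lemma IsDualLattice.exists_repr (φ : V →ₗ[K] K) : ∃ w, ∀ z, b w z = φ z := by
  have := H.finiteDimensional
  obtain ⟨w, hw⟩ := (b.toDual H.nondegenerate).surjective φ
  exact ⟨w, fun z => by rw [← hw]; rfl⟩

lemma IsDualLattice.mem_of_perp (hF : ∀ x ∈ F, ∀ y ∈ F, b x y = 0)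
    (hd : 2 * Module.finrank K F = d) {w : V} (hw : ∀ z ∈ F, b w z = 0) : w ∈ F := by
  have := H.finiteDimensional
  have h : F = b.orthogonal F := by
    apply Submodule.eq_of_le_of_finrank_eq
    · exact fun x hx => LinearMap.BilinForm.mem_orthogonal_iff.2 fun n hn => hF n hn x hx
    · rw [LinearMap.BilinForm.finrank_orthogonal H.nondegenerate, H.finrank_eq]
      omega
  rw [h]
  exact LinearMap.BilinForm.mem_orthogonal_iff.2 fun n hn => (H.symm _ _).trans (hw n hn)

/-- This is `(F ∩ ker t)^⊥ = F + im t` for Lagrangian `F`. On `F` the functional `b(w, ·)` factors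
through `t` as `b(v, t ·)`; then `w + tv` is orthogonal to `F`, hence in `F`, and has the same image
as `w` under `t`. -/
lemma IsDualLattice.map_mem_map_of_perp (hF : ∀ x ∈ F, ∀ y ∈ F, b x y = 0)
    (hd : 2 * Module.finrank K F = d) {w : V} (hw : ∀ z ∈ F, t z = 0 → b w z = 0) :
    ∃ z ∈ F, t z = t w := by
  have h : (b w).domRestrict F ∈ LinearMap.range (t.domRestrict F).dualMap := by
    rw [LinearMap.range_dualMap_eq_dualAnnihilator_ker, Submodule.mem_dualAnnihilator]
    exact fun z hz => hw z z.2 hz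
  obtain ⟨ψ, hψ⟩ := h
  obtain ⟨v, hv⟩ := H.exists_repr ψ
  refine ⟨w + t v, H.mem_of_perp hF hd fun z hz => ?_, ?_⟩
  · have := LinearMap.congr_fun hψ ⟨z, hz⟩
    simp only [LinearMap.dualMap_apply, LinearMap.domRestrict_apply, ← hv] at this
    simp [H.skew, this]
  · simp [H.sq]

/-- The identity `t(G^⊥) = (t⁻¹ G)^⊥` exhibits `G ∩ G^{⊥'}` as the left kernel of the pairing `G ×
t⁻¹(G)`, the form in which it can be base changed and measured by minors. -/
lemma IsDualLattice.mem_map_orthogonal_iff (hG : ∀ x ∈ G, t x = 0) {x : V} :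
    x ∈ (b.orthogonal G).map t ↔ ∀ q, t q ∈ G → b x q = 0 := by
  constructor
  · rintro ⟨y, hy, rfl⟩ q hq
    rw [H.skew, H.symm, LinearMap.BilinForm.mem_orthogonal_iff.1 hy _ hq, neg_zero]
  · intro h
    -- Every `t y` lies in `t⁻¹(G)`, so `x` is orthogonal to `im t`.
    have h0 : t x = 0 := H.eq_zero fun y => by
      rw [H.skew, h _ (by rw [H.sq, zero_smul]; exact G.zero_mem), neg_zero]
    obtain ⟨y, rfl⟩ := H.exists_of_map_eq_zero h0
    refine ⟨y, LinearMap.BilinForm.mem_orthogonal_iff.2 fun g hg => ?_, rfl⟩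
    obtain ⟨q, rfl⟩ := H.exists_of_map_eq_zero (hG g hg)
    have := h q hg
    rw [H.skew] at this
    rw [H.symm]
    exact neg_eq_zero.1 this

lemma IsDualLattice.exists_lift_of_mem_map_orthogonal {x : V} (hx : x ∈ (b.orthogonal G).map t) :
    ∃ u, t u = x ∧ ∀ g ∈ G, b u g = 0 := by
  obtain ⟨u, hu, rfl⟩ := hx
  exact ⟨u, rfl, fun g hg => (H.symm _ _).trans (LinearMap.BilinForm.mem_orthogonal_iff.1 hu g hg)⟩

omit H

/-- Two vectors of `N` with functionals vanishing on `S` and dual to them. -/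
lemma exists_dual_pair {S N : Submodule K V} [FiniteDimensional K V]
    (h : Module.finrank K S + 2 ≤ Module.finrank K N) :
    ∃ g ∈ N, ∃ g' ∈ N, ∃ φ φ' : V →ₗ[K] K, S ≤ LinearMap.ker φ ∧ S ≤ LinearMap.ker φ' ∧
      φ g = 1 ∧ φ g' = 0 ∧ φ' g = 0 ∧ φ' g' = 1 := by
  have key : ∀ T : Submodule K V, Module.finrank K T < Module.finrank K N → ∃ g ∈ N, g ∉ T := by
    intro T hT
    by_contra! hc
    exact absurd (Submodule.finrank_mono (show N ≤ T from hc)) (not_le.2 hT)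
  have key' : ∀ x : V, Module.finrank K (S ⊔ K ∙ x : Submodule K V) ≤ Module.finrank K S + 1 :=
    fun x => (Submodule.finrank_add_le_finrank_add_finrank _ _).trans
      (Nat.add_le_add_left ((finrank_span_le_card {x}).trans (by simp)) _)
  obtain ⟨g, hg, hgS⟩ := key S (by omega)
  obtain ⟨g', hg', hgS'⟩ := key (S ⊔ K ∙ g) (by have := key' g; omega)
  have hgS'' : g ∉ S ⊔ K ∙ g' := by
    intro hmem
    obtain ⟨s, hs, y, hy, rfl⟩ := Submodule.mem_sup.1 hmem
    obtain ⟨c, rfl⟩ := Submodule.mem_span_singleton.1 hy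
    rcases eq_or_ne c 0 with rfl | hc
    · exact hgS (by simpa using hs)
    · apply hgS'
      have h := Submodule.add_mem _ (Submodule.mem_sup_left (S.neg_mem (S.smul_mem c⁻¹ hs)))
        (Submodule.mem_sup_right (Submodule.smul_mem (K ∙ (s + c • g')) c⁻¹
          (Submodule.mem_span_singleton_self _)))
      rw [smul_add, smul_smul, inv_mul_cancel₀ hc, one_smul, neg_add_cancel_left] at h
      exact h
  obtain ⟨φ, h1, h2⟩ := Submodule.exists_le_ker_of_notMem hgS''
  obtain ⟨φ', h1', h2'⟩ := Submodule.exists_le_ker_of_notMem hgS'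
  refine ⟨g, hg, g', hg', (φ g)⁻¹ • φ, (φ' g')⁻¹ • φ', ?_, ?_, ?_, ?_, ?_, ?_⟩
  · intro x hx
    have : φ x = 0 := h2 (Submodule.mem_sup_left hx)
    simp [this]
  · intro x hx
    have : φ' x = 0 := h2' (Submodule.mem_sup_left hx)
    simp [this]
  · simp [h1]
  · have : φ g' = 0 := h2 (Submodule.mem_sup_right (Submodule.mem_span_singleton_self _))
    simp [this]
  · have : φ' g = 0 := h2' (Submodule.mem_sup_right (Submodule.mem_span_singleton_self _))
    simp [this]
  · simp [h1']

/-- Two functionals that are independent on `P` have dual vectors in `P`. -/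
lemma exists_dual_vectors {P : Submodule K V} (φ φ' : V →ₗ[K] K)
    (h : ∀ α α' : K, (∀ z ∈ P, α * φ z + α' * φ' z = 0) → α = 0 ∧ α' = 0) :
    ∃ z ∈ P, ∃ z' ∈ P, φ z = 1 ∧ φ z' = 0 ∧ φ' z = 0 ∧ φ' z' = 1 := by
  let f : P →ₗ[K] Fin 2 → K := LinearMap.pi ![φ.domRestrict P, φ'.domRestrict P]
  have hf : LinearMap.range f = ⊤ := by
    by_contra hne
    obtain ⟨x, hx⟩ := SetLike.exists_not_mem_of_ne_top _ hne rfl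
    obtain ⟨ψ, h1, h2⟩ := Submodule.exists_le_ker_of_notMem hx
    have hψ : ∀ y : Fin 2 → K, ψ y = ψ (Pi.single 0 1) * y 0 + ψ (Pi.single 1 1) * y 1 := by
      intro y
      conv_lhs => rw [show y = y 0 • Pi.single 0 1 + y 1 • Pi.single 1 1 by
        ext i; fin_cases i <;> simp]
      simp only [map_add, map_smul, smul_eq_mul]
      ring
    obtain ⟨e1, e2⟩ := h (ψ (Pi.single 0 1)) (ψ (Pi.single 1 1)) fun z hz => by
      have : ψ (f ⟨z, hz⟩) = 0 := h2 ⟨_, rfl⟩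
      rw [hψ] at this
      simpa [f] using this
    exact h1 (by rw [hψ, e1, e2]; simp)
  rw [LinearMap.range_eq_top] at hf
  obtain ⟨z, hz⟩ := hf ![1, 0]
  obtain ⟨z', hz'⟩ := hf ![0, 1]
  have a1 := congrFun hz 0
  have a2 := congrFun hz 1
  have a3 := congrFun hz' 0
  have a4 := congrFun hz' 1
  simp [f] at a1 a2 a3 a4
  exact ⟨z, z.2, z', z'.2, a1, a3, a2, a4⟩

include H

/-- Two vectors of `N` independent modulo `tF` lift through `t` to `u, v ∈ G^⊥`. The forms `b u` and
`b v` are independent on `F ∩ ker t`: by `map_mem_map_of_perp`, a combination vanishing there would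
put the same combination of `tu, tv` in `tF`. This supplies the dual vectors `z, z'`. -/
lemma IsDualLattice.exists_raising (h2 : (2 : K) ≠ 0) (hp : IsSpecialPair t b F G)
    (hd : 2 * Module.finrank K F = d)
    (hr : Module.finrank K (F.map t) + 2 ≤
      Module.finrank K (G ⊓ (b.orthogonal G).map t : Submodule K V)) :
    ∃ u v z z', IsRaising t b F G u v z z' := by
  have := H.finiteDimensional
  obtain ⟨g, ⟨hg, hgp⟩, g', ⟨hg', hgp'⟩, φ, φ', hφ, hφ', e1, e2, e3, e4⟩ :=
    exists_dual_pair hr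
  obtain ⟨u, rfl, hu⟩ := H.exists_lift_of_mem_map_orthogonal hgp
  obtain ⟨v, rfl, hv⟩ := H.exists_lift_of_mem_map_orthogonal hgp'
  obtain ⟨z, ⟨hz, tz⟩, z', ⟨hz', tz'⟩, uz, uz', vz, vz'⟩ :=
    exists_dual_vectors (P := F ⊓ LinearMap.ker t) (b u) (b v) (by
      intro α α' h
      obtain ⟨x, hx, hx'⟩ := H.map_mem_map_of_perp hp.isotropic hd (w := α • u + α' • v)
        (fun z hz tz => by simpa using h z ⟨hz, tz⟩)
      have i1 : φ (t x) = 0 := hφ ⟨x, hx, rfl⟩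
      have i2 : φ' (t x) = 0 := hφ' ⟨x, hx, rfl⟩
      rw [hx'] at i1 i2
      simp only [map_add, map_smul, e1, e2, e3, e4, smul_eq_mul, mul_one, mul_zero, add_zero,
        zero_add] at i1 i2
      exact ⟨i1, i2⟩)
  replace tz : t z = 0 := tz
  replace tz' : t z' = 0 := tz'
  have zz := hp.isotropic z hz z hz
  have zz' := hp.isotropic z hz z' hz'
  have z'z := hp.isotropic z' hz' z hz
  have z'z' := hp.isotropic z' hz' z' hz'
  have zu := (H.symm z u).trans uz
  have zv := (H.symm z v).trans vz
  have z'u := (H.symm z' u).trans uz'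
  have z'v := (H.symm z' v).trans vz'
  have zG : ∀ g ∈ G, b z g = 0 := fun g hg => hp.isotropic z hz g (hp.le hg)
  have zG' : ∀ g ∈ G, b z' g = 0 := fun g hg => hp.isotropic z' hz' g (hp.le hg)
  -- Since `z, z'` span an isotropic space, are killed by `t` and are orthogonal to `G`, subtracting
  -- them leaves `tu`, `tv` and the orthogonality to `G` unchanged. The coefficients are those that
  -- make `u, v` isotropic and orthogonal to each other.
  refine ⟨u - (b u u / 2) • z, v - (b v v / 2) • z' - (b u v) • z, z, z', ?_⟩
  constructor
  · intro g hg; simp [hu g hg, zG g hg]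
  · intro g hg; simp [hv g hg, zG g hg, zG' g hg]
  · simpa [tz] using hg
  · simpa [tz, tz'] using hg'
  · simp only [map_sub, map_smul, LinearMap.sub_apply, LinearMap.smul_apply, smul_eq_mul, uz, zz, zu]
    field_simp
    ring
  · simp [uz, zz, zz', uz', zv]
  · simp only [map_sub, map_smul, LinearMap.sub_apply, LinearMap.smul_apply, smul_eq_mul, zz, zz',
      z'z, z'z', vz, vz', zv, z'v]
    field_simp
    ring
  all_goals first | assumption | skip
  · simp [zz, uz]
  · simp [zz', uz']
  · simp [zz, z'z, vz]
  · simp [zz', z'z', vz']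

/-- Skewness of `t` and symmetry of `b` make `b(x, t y)` antisymmetric, hence alternating when two
is invertible. -/
lemma IsDualLattice.form_map_self (h2 : (2 : K) ≠ 0) (x : V) : b x (t x) = 0 := by
  have h := H.skew x x
  rw [H.symm] at h
  have : (2 : K) * b x (t x) = 0 := by linear_combination h
  exact (mul_eq_zero.1 this).resolve_left h2

/-- Here `a, a'` are vectors of `N` independent modulo `tF`, and `w, w'` represent functionals dual
to them that vanish on `tF`. By skewness `tw` and `tw'` are then orthogonal to `F`, so they lie in
`F`. -/
lemma IsDualLattice.exists_lowering (h2 : (2 : K) ≠ 0) (hp : IsSpecialPair t b F G)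
    (hd : 2 * Module.finrank K F = d)
    (hr : Module.finrank K (F.map t) + 2 ≤
      Module.finrank K (G ⊓ (b.orthogonal G).map t : Submodule K V)) :
    ∃ w w' a a', IsLowering t b F G w w' a a' := by
  have := H.finiteDimensional
  obtain ⟨a, ⟨ha, hap⟩, a', ⟨ha', hap'⟩, φ, φ', hφ, hφ', e1, e2, e3, e4⟩ :=
    exists_dual_pair hr
  obtain ⟨w, hw⟩ := H.exists_repr φ
  obtain ⟨w', hw'⟩ := H.exists_repr φ'
  have pa := (H.mem_map_orthogonal_iff hp.map_eq_zero).1 hap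
  have pa' := (H.mem_map_orthogonal_iff hp.map_eq_zero).1 hap'
  obtain ⟨x, rfl, hx⟩ := H.exists_lift_of_mem_map_orthogonal hap
  have wp : ∀ y ∈ F, b w (t y) = 0 := fun y hy => (hw _).trans (hφ ⟨y, hy, rfl⟩)
  have wp' : ∀ y ∈ F, b w' (t y) = 0 := fun y hy => (hw' _).trans (hφ' ⟨y, hy, rfl⟩)
  have xp : ∀ y ∈ F, b x (t y) = 0 := fun y hy => hx _ (hp.map_le y hy)
  have mem : ∀ y, (∀ z ∈ F, b y (t z) = 0) → t y ∈ F := fun y hy =>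
    H.mem_of_perp hp.isotropic hd fun z hz => by rw [H.skew, hy z hz, neg_zero]
  have wx : b w (t x) = 1 := (hw _).trans e1
  -- The only missing relation is `b(w, tw') = 0`. It is arranged with a lift `x ∈ G^⊥` of `a`,
  -- since `b(w, tx) = 1`; being orthogonal to `G`, which contains `a`, `a'` and `tF`, the vector
  -- `x` disturbs no other relation.
  have wt : b w (t (w' - b w (t w') • x)) = 0 := by simp [wx]
  have wp'' : ∀ y ∈ F, b (w' - b w (t w') • x) (t y) = 0 := fun y hy => by
    simp [wp' y hy, xp y hy]
  refine ⟨w, w' - b w (t w') • x, t x, a', ?_⟩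
  constructor
  · exact mem _ wp
  · exact mem _ wp''
  · exact wp
  · exact wp''
  · exact H.form_map_self h2 _
  · exact wt
  · have := H.skew w (w' - b w (t w') • x)
    rw [wt, neg_zero, H.symm] at this
    exact this
  · exact H.form_map_self h2 _
  all_goals first | assumption | skip
  · rw [hw, e2]
  · simp [hw', e3, hx _ ha]
  · simp [hw', e4, hx _ ha']

/-- The new `tF` is the direct sum of the old one and the plane spanned by `tu, tv`. -/
lemma IsDualLattice.finrank_raise (hp : IsSpecialPair t b F G) {u v z z' : V}
    (hr : IsRaising t b F G u v z z') {τ : K} (hτ : τ ≠ 0) :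
    Module.finrank K ((F.map (biShear b v u u v τ)).map t) = Module.finrank K (F.map t) + 2 := by
  have := H.finiteDimensional
  have h1 : (F.map (biShear b v u u v τ)).map t = F.map t ⊔ Submodule.span K {t u, t v} := by
    apply le_antisymm
    · rintro _ ⟨_, ⟨x, hx, rfl⟩, rfl⟩
      rw [biShear_apply, map_add]
      refine Submodule.add_mem_sup ⟨x, hx, rfl⟩ ?_
      rw [Submodule.mem_span_pair]
      exact ⟨τ * b v x, -(τ * b u x), by simp [smul_smul, sub_eq_add_neg]⟩
    -- The shear sends `z'` to `z' + τ u` and `z` to `z - τ v`, while `t` kills `z` and `z'`;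
    -- dividing by `τ` yields `tu` and `tv`.
    · have hu : t u ∈ (F.map (biShear b v u u v τ)).map t := by
        refine ⟨_, ⟨τ⁻¹ • z', F.smul_mem _ hr.z'_mem, rfl⟩, ?_⟩
        simp [biShear_apply, hr.tz', hr.uz', hr.vz', hτ]
      have hv : t v ∈ (F.map (biShear b v u u v τ)).map t := by
        refine ⟨_, ⟨-τ⁻¹ • z, F.smul_mem _ hr.z_mem, rfl⟩, ?_⟩
        simp [biShear_apply, hr.tz, hr.uz, hr.vz, hτ]
      refine sup_le ?_ (Submodule.span_le.2 (Set.insert_subset hu (Set.singleton_subset_iff.2 hv)))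
      rintro _ ⟨x, hx, rfl⟩
      have e : t x = t (biShear b v u u v τ x) - (τ * b v x) • t u + (τ * b u x) • t v := by
        simp only [biShear_apply, map_add, map_smul, map_sub, smul_sub, smul_smul]; abel
      rw [e]
      exact Submodule.add_mem _ (Submodule.sub_mem _ ⟨_, ⟨x, hx, rfl⟩, rfl⟩
        (Submodule.smul_mem _ _ hu)) (Submodule.smul_mem _ _ hv)
  have key : ∀ α α' : K, α • t u + α' • t v ∈ F.map t → α = 0 ∧ α' = 0 := by
    rintro α α' ⟨x, hx, hx'⟩
    -- Pairing with `ker t = im t` depends only on the image under `t`, so `α u + α' v` pairs with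
    -- `F ∩ ker t` as `x ∈ F` does, that is, trivially. Testing on `z, z'` gives `α = α' = 0`.
    have aux : ∀ y ∈ F, t y = 0 → b (α • u + α' • v) y = 0 := by
      intro y hy hty
      obtain ⟨y', rfl⟩ := H.exists_of_map_eq_zero hty
      have h3 := hp.isotropic x hx _ hy
      have h4 : b (t x) y' = 0 := by rw [H.skew, h3, neg_zero]
      rw [hx', ← map_smul, ← map_smul, ← map_add, H.skew, neg_eq_zero] at h4
      exact h4
    have i1 := aux z hr.z_mem hr.tz
    have i2 := aux z' hr.z'_mem hr.tz'
    simp [hr.uz, hr.vz, hr.uz', hr.vz'] at i1 i2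
    exact ⟨i1, i2⟩
  have h2 : Module.finrank K (Submodule.span K {t u, t v}) = 2 := by
    have : LinearIndependent K ![t u, t v] := LinearIndependent.pair_iff.2 fun α α' h0 =>
      key α α' (h0 ▸ Submodule.zero_mem _)
    have h5 := finrank_span_eq_card this
    rw [Matrix.range_cons_cons_empty] at h5
    simpa using h5
  have h3 : F.map t ⊓ Submodule.span K {t u, t v} = ⊥ := by
    rw [eq_bot_iff]
    rintro x ⟨hx1, hx2⟩
    obtain ⟨α, α', rfl⟩ := Submodule.mem_span_pair.1 hx2
    obtain ⟨rfl, rfl⟩ := key _ _ hx1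
    simp
  have h4 := Submodule.finrank_sup_add_finrank_inf_eq (F.map t) (Submodule.span K {t u, t v})
  rw [h3, finrank_bot, h2, add_zero] at h4
  rw [h1, h4]

/-- Pulled back to `G`, the alternating form of the sheared space is the old one plus `2τ` times the
wedge of `b w'` and `b w`. Pairing with `a, a'`, which lie in the old radical `N`, forces the new
radical into `ker (b w) ∩ ker (b w')`; there the two forms agree and the shear is the identity. So
the new radical is the part of `N` killed by `b w` and `b w'`, of codimension two because `a, a'`
are dual to them. -/
lemma IsDualLattice.finrank_lower (h2 : (2 : K) ≠ 0) (hp : IsSpecialPair t b F G) {w w' a a' : V}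
    (hr : IsLowering t b F G w w' a a') {τ : K} (hτ : τ ≠ 0) :
    Module.finrank K (G.map (biShear b w (t w') w' (t w) τ) ⊓
        (b.orthogonal (G.map (biShear b w (t w') w' (t w) τ))).map t : Submodule K V) + 2 =
      Module.finrank K (G ⊓ (b.orthogonal G).map t : Submodule K V) := by
  have := H.finiteDimensional
  have ht : ∀ x, t (t x) = 0 := fun x => by rw [H.sq, zero_smul]
  have hp' := hp.lower ht hr τ
  set e := biShear b w (t w') w' (t w) τ with he
  -- lifts through `t`
  let e' : V → V := fun x => x + τ • (b w (t x) • w' - b w' (t x) • w)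
  have hte : ∀ x, t (e' x) = e (t x) := fun x => by simp [e', he, biShear_apply]
  -- The modified pairing of `e x` with `e (t y)` is computed by `b (e x) (e' y)`, as `e'` lifts `e`
  -- through `t`.
  have form : ∀ x ∈ G, ∀ y, t y ∈ G → b (e x) (e' y) =
      b x y + 2 * τ * (b w' x * b w (t y) - b w x * b w' (t y)) := by
    intro x hx y hy
    obtain ⟨x, rfl⟩ := H.exists_of_map_eq_zero (hp.map_eq_zero x hx)
    have k1 : b (t x) w = b w (t x) := H.symm _ _
    have k2 : b (t x) w' = b w' (t x) := H.symm _ _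
    have k3 : b (t w) w = 0 := (H.symm _ _).trans hr.wtw
    have k4 : b (t w) w' = 0 := (H.symm _ _).trans hr.w'tw
    have k5 : b (t w') w = 0 := (H.symm _ _).trans hr.wtw'
    have k6 : b (t w') w' = 0 := (H.symm _ _).trans hr.w'tw'
    have k7 : b (t w) y = -b w (t y) := H.skew _ _
    have k8 : b (t w') y = -b w' (t y) := H.skew _ _
    simp only [e', he, biShear_apply, map_add, map_smul, map_sub, LinearMap.add_apply,
      LinearMap.smul_apply, LinearMap.sub_apply, smul_eq_mul, k1, k2, k3, k4, k5, k6, k7, k8]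
    ring
  have h1 : (G.map e ⊓ (b.orthogonal (G.map e)).map t : Submodule K V) =
      (G ⊓ (b.orthogonal G).map t) ⊓ (LinearMap.ker (b w) ⊓ LinearMap.ker (b w')) := by
    ext x
    simp only [Submodule.mem_inf, H.mem_map_orthogonal_iff hp.map_eq_zero,
      H.mem_map_orthogonal_iff hp'.map_eq_zero, LinearMap.mem_ker]
    constructor
    · rintro ⟨⟨x, hx, rfl⟩, hperp⟩
      have h3 : ∀ y, t y ∈ G → b (e x) (e' y) = 0 := fun y hy =>
        hperp _ (by rw [hte]; exact ⟨_, hy, rfl⟩)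
      obtain ⟨α, hα⟩ := H.exists_of_map_eq_zero (hp.map_eq_zero a hr.a_mem)
      obtain ⟨α', hα'⟩ := H.exists_of_map_eq_zero (hp.map_eq_zero a' hr.a'_mem)
      have hxa : b x α = 0 := by
        obtain ⟨x', rfl⟩ := H.exists_of_map_eq_zero (hp.map_eq_zero x hx)
        rw [H.skew, hα, H.symm, hr.a_perp x' hx, neg_zero]
      have hxa' : b x α' = 0 := by
        obtain ⟨x', rfl⟩ := H.exists_of_map_eq_zero (hp.map_eq_zero x hx)
        rw [H.skew, hα', H.symm, hr.a'_perp x' hx, neg_zero]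
      have i1 := h3 α (hα ▸ hr.a_mem)
      have i2 := h3 α' (hα' ▸ hr.a'_mem)
      rw [form x hx _ (hα ▸ hr.a_mem), hα, hxa, hr.wa, hr.w'a] at i1
      rw [form x hx _ (hα' ▸ hr.a'_mem), hα', hxa', hr.wa', hr.w'a'] at i2
      have j1 : b w' x = 0 := by simpa [h2, hτ] using i1
      have j2 : b w x = 0 := by simpa [h2, hτ] using i2
      have hex : e x = x := by simp [he, biShear_apply, j1, j2]
      rw [hex]
      refine ⟨⟨hx, fun y hy => ?_⟩, j2, j1⟩
      have := h3 y hy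
      rw [form x hx y hy, j1, j2] at this
      simpa using this
    · rintro ⟨⟨hx, hperp⟩, j2, j1⟩
      have hex : e x = x := by simp [he, biShear_apply, j1, j2]
      refine ⟨⟨x, hx, hex⟩, ?_⟩
      rintro q ⟨y, hy, hyq⟩
      obtain ⟨y, rfl⟩ := H.exists_of_map_eq_zero (hp.map_eq_zero y hy)
      -- The element `q` differs from `e' y` by an element of `ker t = im t`, to which `x` is
      -- orthogonal because `t x = 0`.
      have hz : t (q - e' y) = 0 := by rw [map_sub, hte, hyq, sub_self]
      obtain ⟨z, hz⟩ := H.exists_of_map_eq_zero hz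
      have hq : q = e' y + t z := by rw [hz]; abel
      have := form x hx y hy
      rw [hex, j1, j2, hperp y hy] at this
      rw [hq, map_add, this, H.symm x, H.skew, hp.map_eq_zero x hx]
      simp
  set N := (G ⊓ (b.orthogonal G).map t : Submodule K V) with hN
  have ha : a ∈ N := ⟨hr.a_mem, (H.mem_map_orthogonal_iff hp.map_eq_zero).2 hr.a_perp⟩
  have ha' : a' ∈ N := ⟨hr.a'_mem, (H.mem_map_orthogonal_iff hp.map_eq_zero).2 hr.a'_perp⟩
  let f : N →ₗ[K] Fin 2 → K := LinearMap.pi ![(b w).domRestrict N, (b w').domRestrict N]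
  have hf : LinearMap.range f = ⊤ := by
    rw [eq_top_iff]
    intro y _
    refine ⟨y 0 • ⟨a, ha⟩ + y 1 • ⟨a', ha'⟩, ?_⟩
    ext i
    fin_cases i <;> simp [f, hr.wa, hr.wa', hr.w'a, hr.w'a']
  have hk : LinearMap.ker f = (N ⊓ (LinearMap.ker (b w) ⊓ LinearMap.ker (b w'))).comap N.subtype := by
    ext x
    simp [f, LinearMap.mem_ker, funext_iff, Fin.forall_fin_two]
  have h3 := LinearMap.finrank_range_add_finrank_ker f
  rw [hf, finrank_top, Module.finrank_fin_fun, hk,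
    (Submodule.comapSubtypeEquivOfLe inf_le_left).finrank_eq] at h3
  rw [h1]
  omega

omit H in
/-- A nondegenerate alternating form lives on an even-dimensional space. -/
lemma even_finrank_of_alternating {W : Type*} [AddCommGroup W] [Module K W] [FiniteDimensional K W]
    (h2 : (2 : K) ≠ 0) (β : LinearMap.BilinForm K W) (hskew : ∀ x y, β x y = -β y x)
    (hβ : ∀ x, (∀ y, β x y = 0) → x = 0) : Even (Module.finrank K W) := by
  let e := Module.finBasis K W
  have hn : β.Nondegenerate := ⟨hβ, fun y hy => hβ y fun x => by rw [hskew, hy x, neg_zero]⟩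
  have h1 := (LinearMap.BilinForm.nondegenerate_iff_det_ne_zero e).1 hn
  have h3 : (LinearMap.BilinForm.toMatrix e β).transpose = -LinearMap.BilinForm.toMatrix e β := by
    ext i j
    simp only [Matrix.transpose_apply, Matrix.neg_apply, LinearMap.BilinForm.toMatrix_apply]
    exact hskew _ _
  have h4 := congrArg Matrix.det h3
  rw [Matrix.det_transpose, Matrix.det_neg, Fintype.card_fin] at h4
  by_contra hodd
  rw [Nat.not_even_iff_odd] at hodd
  rw [hodd.neg_one_pow] at h4
  apply h1
  have : (2 : K) * (LinearMap.BilinForm.toMatrix e β).det = 0 := by linear_combination h4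
  exact (mul_eq_zero.1 this).resolve_left h2

/-- On `G` the modified pairing is `b(x, j y)`, since `j` is a section of `t` over `G`. It is skew
with radical `G ∩ G^{⊥'}`, hence nondegenerate on a complement `W`, whose dimension must be even. -/
lemma IsDualLattice.finrank_inf_modEq (h2 : (2 : K) ≠ 0) (hG : ∀ x ∈ G, t x = 0) :
    Module.finrank K (G ⊓ (b.orthogonal G).map t : Submodule K V) ≡ Module.finrank K G [MOD 2] := by
  have := H.finiteDimensional
  obtain ⟨j, hj⟩ := H.homotopy
  have hjG : ∀ x ∈ G, t (j x) = x := fun x hx => by simpa [hG x hx] using hj x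
  set N := (G ⊓ (b.orthogonal G).map t : Submodule K V).comap G.subtype with hN
  obtain ⟨W, hW⟩ := N.exists_isCompl
  have hfr : Module.finrank K N = Module.finrank K (G ⊓ (b.orthogonal G).map t : Submodule K V) :=
    (Submodule.comapSubtypeEquivOfLe inf_le_left).finrank_eq
  let β : LinearMap.BilinForm K W := b.compl₁₂ (G.subtype ∘ₗ W.subtype)
    (j ∘ₗ G.subtype ∘ₗ W.subtype)
  have hβ : ∀ x y : W, β x y = b (x : V) (j (y : V)) := fun x y => rfl
  have hskew : ∀ x ∈ G, ∀ y ∈ G, b x (j y) = -b y (j x) := by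
    intro x hx y hy
    conv_lhs => rw [← hjG x hx]
    rw [H.skew, hjG y hy, H.symm]
  have hev := even_finrank_of_alternating h2 β (fun x y => hskew _ x.1.2 _ y.1.2) (by
    intro x hx
    have hxN : x.1 ∈ N := by
      refine ⟨x.1.2, (H.mem_map_orthogonal_iff hG).2 fun q hq => ?_⟩
      -- Both `q` and `j (t q)` lift `t q`, so they differ by an element of `im t`, which is
      -- orthogonal to `G`.
      have h1 : b (x : V) q = b (x : V) (j (t q)) := by
        obtain ⟨q', hq'⟩ := H.exists_of_map_eq_zero (x := q - j (t q)) (by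
          rw [map_sub, hjG _ hq, sub_self])
        have : q = j (t q) + t q' := by rw [hq']; abel
        conv_lhs => rw [this]
        rw [map_add, H.symm _ (t q'), H.skew, hG _ x.1.2]
        simp
      change b (x : V) q = 0
      rw [h1]
      have hmem : (⟨t q, hq⟩ : G) ∈ N ⊔ W := by rw [hW.sup_eq_top]; trivial
      obtain ⟨n, hn, y, hy, hny⟩ := Submodule.mem_sup.1 hmem
      have hny' : t q = n + y := (congrArg Subtype.val hny).symm
      rw [hny', map_add, map_add, hskew _ x.1.2 _ n.2,
        show b (n : V) (j x.1.1) = 0 from (H.mem_map_orthogonal_iff hG).1 hn.2 _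
          (by rw [hjG _ x.1.2]; exact x.1.2), neg_zero, zero_add]
      exact hx ⟨y, hy⟩
    exact Subtype.ext (Submodule.disjoint_def.1 hW.disjoint _ hxN x.2))
  have hsum := Submodule.finrank_add_eq_of_isCompl hW
  rw [← hfr, ← hsum]
  obtain ⟨k, hk⟩ := hev
  rw [hk]
  unfold Nat.ModEq
  omega

end Field

/-! ## Base change -/

section BaseChange

variable {C : Type u} [CommRing C] {L : Type u} [AddCommGroup L] [Module C L]
  {t : L →ₗ[C] L} {b : LinearMap.BilinForm C L}

lemma IsDualLattice.baseChange {c : C} {d : ℕ} (H : IsDualLattice t b c d) (R : Type u) [CommRing R]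
    [Algebra C R] : IsDualLattice (t.baseChange R) (b.baseChange R) (algebraMap C R c) d where
  symm x y := by
    induction x with
    | zero => simp
    | add x x' hx hx' => simp only [map_add, LinearMap.add_apply, hx, hx']
    | tmul a l =>
      induction y with
      | zero => simp
      | add y y' hy hy' => simp only [map_add, LinearMap.add_apply, hy, hy']
      | tmul a' l' => simp [H.symm l l', mul_comm a a']
  skew x y := by
    induction x with
    | zero => simp
    | add x x' hx hx' => simp only [map_add, LinearMap.add_apply, hx, hx', neg_add]
    | tmul a l =>
      induction y with
      | zero => simp
      | add y y' hy hy' => simp only [map_add, hy, hy', neg_add]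
      | tmul a' l' => simp [H.skew l l']
  sq x := by
    induction x with
    | zero => simp
    | add x x' hx hx' => simp only [map_add, hx, hx', smul_add]
    | tmul a l => simp [H.sq, TensorProduct.smul_tmul']
  homotopy := by
    obtain ⟨j, hj⟩ := H.homotopy
    refine ⟨j.baseChange R, fun x => ?_⟩
    induction x with
    | zero => simp
    | add x x' hx hx' =>
      simp only [map_add]
      rw [add_add_add_comm, hx, hx']
    | tmul a l => simp [← TensorProduct.tmul_add, hj]
  dual := by
    obtain ⟨β, γ, h⟩ := H.dual
    refine ⟨β.baseChange R, fun i => 1 ⊗ₜ γ i, fun i k => ?_⟩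
    simp only [Module.Basis.baseChange_apply, LinearMap.BilinForm.baseChange_tmul, h]
    split_ifs <;> simp

lemma IsDualLattice.baseChange_zero {ϖ : C} {d : ℕ} (H : IsDualLattice t b (ϖ ^ 2) d) {R : Type u}
    [CommRing R] [Algebra C R] (hϖ : algebraMap C R ϖ = 0) :
    IsDualLattice (t.baseChange R) (b.baseChange R) 0 d := by
  simpa [hϖ] using H.baseChange R

lemma shiftOp_eq {ϖ : C} {R : Type u} [CommRing R] [Algebra C R] (hϖ : algebraMap C R ϖ = 0) :
    shiftOp t ϖ R = t.baseChange R := by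
  simp [shiftOp, hϖ]

lemma shiftOp_neg_eq {ϖ : C} {R : Type u} [CommRing R] [Algebra C R]
    (hϖ : algebraMap C R ϖ = 0) : shiftOp t (-ϖ) R = t.baseChange R := by
  simp [shiftOp, hϖ]

lemma baseChange_rTensor (t : L →ₗ[C] L) {R S : Type u} [CommRing R]
    [Algebra C R] [CommRing S] [Algebra C S] (f : R →ₐ[C] S) (x : R ⊗[C] L) :
    t.baseChange S (f.toLinearMap.rTensor L x) = f.toLinearMap.rTensor L (t.baseChange R x) := by
  simpa [shiftOp] using shiftOp_rTensor t 0 f x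

lemma rTensor_smul {R S : Type u} [CommRing R] [Algebra C R] [CommRing S] [Algebra C S]
    (f : R →ₐ[C] S) (a : R) (x : R ⊗[C] L) :
    f.toLinearMap.rTensor L (a • x) = f a • f.toLinearMap.rTensor L x := by
  induction x with
  | zero => simp
  | add x y hx hy => simp only [map_add, smul_add, hx, hy]
  | tmul a l => simp [TensorProduct.smul_tmul']

lemma biShear_rTensor {R S : Type u} [CommRing R] [Algebra C R] [CommRing S] [Algebra C S]
    (f : R →ₐ[C] S) (p q p' q' : R ⊗[C] L) (τ : R) (x : R ⊗[C] L) :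
    biShear (b.baseChange S) (f.toLinearMap.rTensor L p) (f.toLinearMap.rTensor L q)
      (f.toLinearMap.rTensor L p') (f.toLinearMap.rTensor L q') (f τ)
      (f.toLinearMap.rTensor L x) =
    f.toLinearMap.rTensor L (biShear (b.baseChange R) p q p' q' τ x) := by
  simp only [biShear_apply, map_add, map_sub, rTensor_smul, baseChange_form_rTensor]

lemma map_span_rTensor {R S : Type u} [CommRing R] [Algebra C R] [CommRing S] [Algebra C S]
    (f : R →ₐ[C] S) {φ : R ⊗[C] L →ₗ[R] R ⊗[C] L} {ψ : S ⊗[C] L →ₗ[S] S ⊗[C] L}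
    (h : ∀ x, ψ (f.toLinearMap.rTensor L x) = f.toLinearMap.rTensor L (φ x))
    (N : Submodule R (R ⊗[C] L)) :
    (Submodule.span S (f.toLinearMap.rTensor L '' N)).map ψ =
      Submodule.span S (f.toLinearMap.rTensor L '' (N.map φ)) := by
  rw [Submodule.map_span, Submodule.map_coe, Set.image_image, Set.image_image]
  simp only [h]

lemma form_eq_zero_of_mem_span {R S : Type u} [CommRing R] [Algebra C R] [CommRing S] [Algebra C S]
    (f : R →ₐ[C] S) {N : Submodule R (R ⊗[C] L)} {u : R ⊗[C] L}
    (h : ∀ g ∈ N, b.baseChange R u g = 0) :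
    ∀ g ∈ Submodule.span S (f.toLinearMap.rTensor L '' N),
      b.baseChange S (f.toLinearMap.rTensor L u) g = 0 := by
  intro g hg
  induction hg using Submodule.span_induction with
  | zero => simp
  | add x y _ _ hx hy => rw [map_add, hx, hy, add_zero]
  | smul c x _ hx => rw [map_smul, hx, smul_zero]
  | mem x hx =>
    obtain ⟨x, hx, rfl⟩ := hx
    rw [baseChange_form_rTensor, h x hx, map_zero]

lemma IsRaising.baseChange {R S : Type u} [CommRing R] [Algebra C R] [CommRing S] [Algebra C S]
    {F G : Submodule R (R ⊗[C] L)} {u v z z' : R ⊗[C] L}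
    (h : IsRaising (t.baseChange R) (b.baseChange R) F G u v z z') (f : R →ₐ[C] S) :
    IsRaising (t.baseChange S) (b.baseChange S)
      (Submodule.span S (f.toLinearMap.rTensor L '' F))
      (Submodule.span S (f.toLinearMap.rTensor L '' G))
      (f.toLinearMap.rTensor L u) (f.toLinearMap.rTensor L v)
      (f.toLinearMap.rTensor L z) (f.toLinearMap.rTensor L z') where
  u_perp := form_eq_zero_of_mem_span f h.u_perp
  v_perp := form_eq_zero_of_mem_span f h.v_perp
  tu_mem := by rw [baseChange_rTensor]; exact Submodule.subset_span ⟨_, h.tu_mem, rfl⟩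
  tv_mem := by rw [baseChange_rTensor]; exact Submodule.subset_span ⟨_, h.tv_mem, rfl⟩
  uu := by rw [baseChange_form_rTensor, h.uu, map_zero]
  uv := by rw [baseChange_form_rTensor, h.uv, map_zero]
  vv := by rw [baseChange_form_rTensor, h.vv, map_zero]
  z_mem := Submodule.subset_span ⟨_, h.z_mem, rfl⟩
  z'_mem := Submodule.subset_span ⟨_, h.z'_mem, rfl⟩
  tz := by rw [baseChange_rTensor, h.tz, map_zero]
  tz' := by rw [baseChange_rTensor, h.tz', map_zero]
  uz := by rw [baseChange_form_rTensor, h.uz, map_one]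
  uz' := by rw [baseChange_form_rTensor, h.uz', map_zero]
  vz := by rw [baseChange_form_rTensor, h.vz, map_zero]
  vz' := by rw [baseChange_form_rTensor, h.vz', map_one]

lemma span_range_rTensor {R S : Type u} [CommRing R] [Algebra C R] [CommRing S] [Algebra C S]
    (f : R →ₐ[C] S) :
    Submodule.span S (f.toLinearMap.rTensor L '' ((⊤ : Submodule R (R ⊗[C] L)) : Set _)) = ⊤ := by
  rw [eq_top_iff]
  intro x _
  induction x with
  | zero => exact Submodule.zero_mem _
  | add x y hx hy => exact Submodule.add_mem _ (hx trivial) (hy trivial)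
  | tmul a l =>
    have : a ⊗ₜ[C] l = a • f.toLinearMap.rTensor L (1 ⊗ₜ l) := by
      simp [TensorProduct.smul_tmul']
    rw [this]
    exact Submodule.smul_mem _ _ (Submodule.subset_span ⟨_, trivial, rfl⟩)

/-- Base change commutes with the preimage under `t` of a submodule killed by `t`. -/
lemma comap_span_rTensor {ϖ : C} {d : ℕ} (H : IsDualLattice t b (ϖ ^ 2) d) {R S : Type u}
    [CommRing R] [Algebra C R] [CommRing S] [Algebra C S] (hϖ : algebraMap C R ϖ = 0)
    (f : R →ₐ[C] S) {G : Submodule R (R ⊗[C] L)} (hG : ∀ g ∈ G, t.baseChange R g = 0) :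
    (Submodule.span S (f.toLinearMap.rTensor L '' G)).comap (t.baseChange S) =
      Submodule.span S (f.toLinearMap.rTensor L '' (G.comap (t.baseChange R))) := by
  have HR := H.baseChange_zero hϖ
  have HS := H.baseChange_zero (R := S) (by rw [← f.commutes, hϖ, map_zero])
  set Q := Submodule.span S (f.toLinearMap.rTensor L '' (G.comap (t.baseChange R))) with hQ
  apply le_antisymm
  · intro x hx
    -- It suffices that `t` maps `Q` onto the base change of `G` and that `Q` contains `im t = ker
    -- t`.
    have h1 : Submodule.span S (f.toLinearMap.rTensor L '' G) ≤ Q.map (t.baseChange S) := by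
      rw [Submodule.span_le]
      rintro _ ⟨y, hy, rfl⟩
      obtain ⟨x, rfl⟩ := HR.exists_of_map_eq_zero (hG y hy)
      exact ⟨_, Submodule.subset_span ⟨x, hy, rfl⟩, baseChange_rTensor t f x⟩
    have h2 : ∀ w, t.baseChange S w ∈ Q := by
      intro w
      have hw : t.baseChange S w ∈ (⊤ : Submodule S (S ⊗[C] L)).map (t.baseChange S) :=
        ⟨w, trivial, rfl⟩
      rw [← span_range_rTensor f, map_span_rTensor f (baseChange_rTensor t f)] at hw
      refine Submodule.span_mono (Set.image_mono ?_) hw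
      rintro _ ⟨y, -, rfl⟩
      change t.baseChange R (t.baseChange R y) ∈ G
      rw [HR.sq, zero_smul]
      exact G.zero_mem
    obtain ⟨x', hx', e⟩ := h1 hx
    obtain ⟨w, hw⟩ := HS.exists_of_map_eq_zero (x := x - x') (by rw [map_sub, e, sub_self])
    rw [← sub_add_cancel x x', ← hw]
    exact Q.add_mem (h2 w) hx'
  · rw [hQ, Submodule.span_le]
    rintro _ ⟨x, hx, rfl⟩
    rw [SetLike.mem_coe, Submodule.mem_comap, baseChange_rTensor]
    exact Submodule.subset_span ⟨_, hx, rfl⟩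

/-- Only `a_perp` and `a'_perp` are not formal: they range over all of `t⁻¹(G)`, whose formation
commutes with base change by `comap_span_rTensor`. -/
lemma IsLowering.baseChange {ϖ : C} {d : ℕ} (H : IsDualLattice t b (ϖ ^ 2) d) {R S : Type u}
    [CommRing R] [Algebra C R] [CommRing S] [Algebra C S] (hϖ : algebraMap C R ϖ = 0)
    {F G : Submodule R (R ⊗[C] L)} (hG : ∀ g ∈ G, t.baseChange R g = 0) {w w' a a' : R ⊗[C] L}
    (h : IsLowering (t.baseChange R) (b.baseChange R) F G w w' a a') (f : R →ₐ[C] S) :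
    IsLowering (t.baseChange S) (b.baseChange S)
      (Submodule.span S (f.toLinearMap.rTensor L '' F))
      (Submodule.span S (f.toLinearMap.rTensor L '' G))
      (f.toLinearMap.rTensor L w) (f.toLinearMap.rTensor L w')
      (f.toLinearMap.rTensor L a) (f.toLinearMap.rTensor L a') := by
  have perp : ∀ y, (∀ x ∈ F, b.baseChange R y (t.baseChange R x) = 0) →
      ∀ x ∈ Submodule.span S (f.toLinearMap.rTensor L '' F),
        b.baseChange S (f.toLinearMap.rTensor L y) (t.baseChange S x) = 0 := by
    intro y hy x hx
    have h1 := form_eq_zero_of_mem_span (b := b) f (N := F.map (t.baseChange R)) (u := y) (by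
      rintro _ ⟨x, hx, rfl⟩
      exact hy x hx)
    rw [← map_span_rTensor f (baseChange_rTensor t f)] at h1
    exact h1 _ ⟨x, hx, rfl⟩
  have perp' : ∀ y, (∀ x, t.baseChange R x ∈ G → b.baseChange R y x = 0) →
      ∀ x, t.baseChange S x ∈ Submodule.span S (f.toLinearMap.rTensor L '' G) →
        b.baseChange S (f.toLinearMap.rTensor L y) x = 0 := by
    intro y hy x hx
    refine form_eq_zero_of_mem_span f (N := G.comap (t.baseChange R)) hy x ?_
    rwa [← comap_span_rTensor H hϖ f hG]
  exact
  { tw_mem := by rw [baseChange_rTensor]; exact Submodule.subset_span ⟨_, h.tw_mem, rfl⟩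
    tw'_mem := by rw [baseChange_rTensor]; exact Submodule.subset_span ⟨_, h.tw'_mem, rfl⟩
    w_perp := perp _ h.w_perp
    w'_perp := perp _ h.w'_perp
    wtw := by rw [baseChange_rTensor, baseChange_form_rTensor, h.wtw, map_zero]
    wtw' := by rw [baseChange_rTensor, baseChange_form_rTensor, h.wtw', map_zero]
    w'tw := by rw [baseChange_rTensor, baseChange_form_rTensor, h.w'tw, map_zero]
    w'tw' := by rw [baseChange_rTensor, baseChange_form_rTensor, h.w'tw', map_zero]
    a_mem := Submodule.subset_span ⟨_, h.a_mem, rfl⟩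
    a'_mem := Submodule.subset_span ⟨_, h.a'_mem, rfl⟩
    a_perp := perp' _ h.a_perp
    a'_perp := perp' _ h.a'_perp
    wa := by rw [baseChange_form_rTensor, h.wa, map_one]
    wa' := by rw [baseChange_form_rTensor, h.wa', map_zero]
    w'a := by rw [baseChange_form_rTensor, h.w'a, map_zero]
    w'a' := by rw [baseChange_form_rTensor, h.w'a', map_one] }

end BaseChange

/-! ## Splitting pairs on the special fiber -/

section SpecialFiber

variable {C : Type u} [CommRing C] {L : Type u} [AddCommGroup L] [Module C L]
  {t : L →ₗ[C] L} {b : LinearMap.BilinForm C L} {ϖ : C} {n r s : ℕ}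

lemma IsSplittingPair.isSpecialPair {R : Type u} [CommRing R] [Algebra C R]
    (hϖ : algebraMap C R ϖ = 0) {F : G(n, (R ⊗[C] L); R)} {G : G(n + r, (R ⊗[C] L); R)}
    (h : IsSplittingPair t b ϖ n r s F G) :
    IsSpecialPair (t.baseChange R) (b.baseChange R) F.toSubmodule G.toSubmodule where
  le := h.le
  isotropic := h.isotropic
  map_le x hx := by
    rw [← shiftOp_eq hϖ]
    exact h.map_add_le ⟨x, hx, rfl⟩
  map_eq_zero x hx := by
    rw [← shiftOp_neg_eq hϖ]
    have : shiftOp t (-ϖ) R x ∈ G.toSubmodule.map (shiftOp t (-ϖ) R) := ⟨x, hx, rfl⟩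
    rwa [h.map_sub_eq_bot] at this

lemma IsSpecialPair.isSplittingPair {R : Type u} [CommRing R] [Algebra C R]
    (hϖ : algebraMap C R ϖ = 0) {F : G(n, (R ⊗[C] L); R)} {G : G(n + r, (R ⊗[C] L); R)}
    (h : IsSpecialPair (t.baseChange R) (b.baseChange R) F.toSubmodule G.toSubmodule)
    (hspin : ∀ p : PrimeSpectrum R,
      Module.finrank p.asIdeal.ResidueField
        ((Module.Grassmannian.map (IsScalarTower.toAlgHom C R p.asIdeal.ResidueField)
          F).toSubmodule.map (shiftOp t ϖ p.asIdeal.ResidueField)) ≡ s [MOD 2]) :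
    IsSplittingPair t b ϖ n r s F G where
  le := h.le
  isotropic := h.isotropic
  map_add_le := by
    rw [shiftOp_eq hϖ]
    rintro _ ⟨x, hx, rfl⟩
    exact h.map_le x hx
  map_sub_eq_bot := by
    rw [shiftOp_neg_eq hϖ, eq_bot_iff]
    rintro _ ⟨x, hx, rfl⟩
    exact h.map_eq_zero x hx
  spin := hspin

/-- The image of a point of a Grassmannian under an automorphism of the module. -/
def grassmannianCongr {R M : Type*} [CommRing R] [AddCommGroup M] [Module R M] {k : ℕ}
    (e : M ≃ₗ[R] M) (N : G(k, M; R)) : G(k, M; R) where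
  toSubmodule := N.toSubmodule.map e.toLinearMap
  finite_quotient := Module.Finite.equiv (Submodule.Quotient.equiv N.toSubmodule _ e rfl)
  projective_quotient := Module.Projective.of_equiv (Submodule.Quotient.equiv N.toSubmodule _ e rfl)
  rankAtStalk_eq p := (congrFun (Module.rankAtStalk_eq_of_equiv
    (Submodule.Quotient.equiv N.toSubmodule _ e rfl)).symm p).trans (N.rankAtStalk_eq p)

/-- The index of `G(k, V; K)` is the rank of the quotient, so it counts codimension. -/
lemma finrank_grassmannian_add {K V : Type*} [Field K] [AddCommGroup V] [Module K V]
    [FiniteDimensional K V] {k : ℕ} (N : G(k, V; K)) :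
    Module.finrank K N.toSubmodule + k = Module.finrank K V := by
  rw [← N.toSubmodule.finrank_quotient_add_finrank, add_comm]
  congr 1
  have := N.rankAtStalk_eq ⊥
  rw [Module.rankAtStalk_eq_finrank_of_free] at this
  simpa using this.symm

end SpecialFiber

/-! ## Functoriality of the underlying space -/

namespace PointSpace

variable {C : Type u} [CommRing C] {M : CommAlgCat.{u} C ⥤ Type u}

lemma map_comp_apply {R S T : Type u} [CommRing R] [Algebra C R] [CommRing S] [Algebra C S]
    [CommRing T] [Algebra C T] (f : R →ₐ[C] S) (g : S →ₐ[C] T) (ξ : M.obj (CommAlgCat.of C R)) :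
    M.map (CommAlgCat.ofHom g) (M.map (CommAlgCat.ofHom f) ξ) =
      M.map (CommAlgCat.ofHom (g.comp f)) ξ := by
  rw [CommAlgCat.ofHom_comp, Functor.map_comp_apply]

lemma ofPoint_map {R S : Type u} [CommRing R] [Algebra C R] [CommRing S] [Algebra C S]
    (f : R →ₐ[C] S) (ξ : M.obj (CommAlgCat.of C R)) (q : PrimeSpectrum S) :
    ofPoint (M.map (CommAlgCat.ofHom f) ξ) q = ofPoint ξ (PrimeSpectrum.comap f.toRingHom q) := by
  symm
  let p : PrimeSpectrum R := PrimeSpectrum.comap f.toRingHom q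
  let g : p.asIdeal.ResidueField →ₐ[C] q.asIdeal.ResidueField :=
    Ideal.ResidueField.mapₐ p.asIdeal q.asIdeal f rfl
  have hg : (IsScalarTower.toAlgHom C S q.asIdeal.ResidueField).comp f =
      g.comp (IsScalarTower.toAlgHom C R p.asIdeal.ResidueField) := by
    ext x
    exact (Ideal.ResidueField.map_algebraMap p.asIdeal q.asIdeal f.toRingHom rfl x).symm
  refine Quot.sound ⟨g, ?_⟩
  change M.map (CommAlgCat.ofHom g) (M.map (CommAlgCat.ofHom _) ξ) = M.map (CommAlgCat.ofHom _) _
  rw [map_comp_apply, map_comp_apply, hg]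

lemma ofPoint_field {K : Type u} [Field K] [Algebra C K] (ξ : M.obj (CommAlgCat.of C K))
    (p : PrimeSpectrum K) : ofPoint ξ p = mk ⟨K, ξ⟩ :=
  (Quot.sound ⟨IsScalarTower.toAlgHom C K p.asIdeal.ResidueField, rfl⟩).symm

/-- The generic point of a family over the affine line specializes to the point at the origin. -/
lemma specializes_of_family {K : Type u} [Field K] [Algebra C K]
    (ξ : M.obj (CommAlgCat.of C (Polynomial K))) {U : Set (PointSpace M)} (hU : IsOpen U)
    (h : mk ⟨K, M.map (CommAlgCat.ofHom
      ((Polynomial.aeval (0 : K)).restrictScalars C)) ξ⟩ ∈ U) :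
    ofPoint ξ ⊥ ∈ U := by
  have h1 := isOpen_iff.1 hU _ ξ
  rw [← ofPoint_field _ ⊥, ofPoint_map] at h
  exact ((PrimeSpectrum.le_iff_specializes ⊥ _).1 bot_le).mem_open h1 h

/-- Vanishing of a scalar at a point. -/
def Vanishes (ϖ : C) : PointSpace M → Prop :=
  Quot.lift (fun x => algebraMap C x.K ϖ = 0) (by
    rintro x y ⟨f, -⟩
    rw [← f.commutes]
    exact propext (map_eq_zero f.toRingHom).symm)

lemma exists_mk_eq (P : PointSpace M) : ∃ x, mk x = P := Quot.exists_rep P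

lemma vanishes_ofPoint {ϖ : C} {R : Type u} [CommRing R] [Algebra C R]
    (ξ : M.obj (CommAlgCat.of C R)) (p : PrimeSpectrum R) :
    Vanishes ϖ (ofPoint ξ p) ↔ algebraMap C R ϖ ∈ p.asIdeal := by
  change algebraMap C p.asIdeal.ResidueField ϖ = 0 ↔ _
  rw [IsScalarTower.algebraMap_apply C R, Ideal.algebraMap_residueField_eq_zero]

end PointSpace

/-! ## Degenerations of splitting pairs -/

section Families

variable {C : Type u} [CommRing C] {L : Type u} [AddCommGroup L] [Module C L]
  {t : L →ₗ[C] L} {b : LinearMap.BilinForm C L} {ϖ : C} {n r s : ℕ}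

lemma algebraMap_eq_zero_of_algHom {R S : Type u} [CommRing R] [Algebra C R] [CommRing S]
    [Algebra C S] (f : R →ₐ[C] S) (hϖ : algebraMap C R ϖ = 0) : algebraMap C S ϖ = 0 := by
  rw [← f.commutes, hϖ, map_zero]

/-- Shears commute with base change, so the fibre of a sheared constant family is the sheared fibre,
with parameter the value of `τ`. It is used for `f` the inclusion of constants and `g` a point of
the line. -/
lemma grassmannian_map_congr {k : ℕ} {R S T : Type u} [CommRing R] [Algebra C R] [CommRing S]
    [Algebra C S] [CommRing T] [Algebra C T] (f : R →ₐ[C] S) (g : S →ₐ[C] T)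
    (N : G(k, (R ⊗[C] L); R)) {p q p' q' : R ⊗[C] L} {τ : S} {e : S ⊗[C] L ≃ₗ[S] S ⊗[C] L}
    (he : e.toLinearMap = biShear (b.baseChange S) (f.toLinearMap.rTensor L p)
      (f.toLinearMap.rTensor L q) (f.toLinearMap.rTensor L p') (f.toLinearMap.rTensor L q') τ) :
    (Module.Grassmannian.map g
        (grassmannianCongr e (Module.Grassmannian.map f N))).toSubmodule =
      (Module.Grassmannian.map (g.comp f) N).toSubmodule.map
        (biShear (b.baseChange T) ((g.comp f).toLinearMap.rTensor L p)
          ((g.comp f).toLinearMap.rTensor L q) ((g.comp f).toLinearMap.rTensor L p')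
          ((g.comp f).toLinearMap.rTensor L q') (g τ)) := by
  have hc : ∀ x : R ⊗[C] L, (g.comp f).toLinearMap.rTensor L x =
      g.toLinearMap.rTensor L (f.toLinearMap.rTensor L x) := fun x => by
    rw [AlgHom.comp_toLinearMap, LinearMap.rTensor_comp, LinearMap.comp_apply]
  rw [Module.Grassmannian.map_comp, grassmannian_map_toSubmodule g,
    grassmannian_map_toSubmodule g, hc, hc, hc, hc,
    map_span_rTensor g (fun x => biShear_rTensor g _ _ _ _ τ x)]
  exact congrArg (fun φ => Submodule.span T (g.toLinearMap.rTensor L ''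
    (((Module.Grassmannian.map f N).toSubmodule.map φ : Submodule S (S ⊗[C] L)) : Set _))) he

variable (H : IsDualLattice t b (ϖ ^ 2) (2 * n)) {K : Type u} [Field K] [Algebra C K]

include H in
-- The spin condition survives because the rank of `t` on the fibre of the family is unchanged where
-- `τ` vanishes and greater by exactly two elsewhere.
lemma isSplittingPair_raise (hϖ : algebraMap C K ϖ = 0)
    {F : G(n, (K ⊗[C] L); K)} {G : G(n + r, (K ⊗[C] L); K)}
    (hP : IsSplittingPair t b ϖ n r s F G) {u v z z' : K ⊗[C] L}
    (hr : IsRaising (t.baseChange K) (b.baseChange K) F.toSubmodule G.toSubmodule u v z z')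
    {S : Type u} [CommRing S] [Algebra C S] (f : K →ₐ[C] S) (τ : S)
    {e : S ⊗[C] L ≃ₗ[S] S ⊗[C] L}
    (he : e.toLinearMap = biShear (b.baseChange S) (f.toLinearMap.rTensor L v)
      (f.toLinearMap.rTensor L u) (f.toLinearMap.rTensor L u) (f.toLinearMap.rTensor L v) τ) :
    IsSplittingPair t b ϖ n r s (grassmannianCongr e (Module.Grassmannian.map f F))
      (Module.Grassmannian.map f G) := by
  have hS := algebraMap_eq_zero_of_algHom f hϖ
  have hF : (grassmannianCongr e (Module.Grassmannian.map f F)).toSubmodule =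
      (Module.Grassmannian.map f F).toSubmodule.map _ :=
    congrArg (Submodule.map · (Module.Grassmannian.map f F).toSubmodule) he
  have hrS := hr.baseChange f
  rw [← grassmannian_map_toSubmodule, ← grassmannian_map_toSubmodule] at hrS
  refine IsSpecialPair.isSplittingPair hS ?_ fun p => ?_
  · rw [hF]
    exact ((hP.map f).isSpecialPair hS).raise (H.baseChange_zero hS).symm hrS τ
  · let g := IsScalarTower.toAlgHom C S p.asIdeal.ResidueField
    have hE := algebraMap_eq_zero_of_algHom g hS
    rw [grassmannian_map_congr f g F he, shiftOp_eq hE]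
    have hrE := hr.baseChange (g.comp f)
    rw [← grassmannian_map_toSubmodule, ← grassmannian_map_toSubmodule] at hrE
    have hspin : Module.finrank p.asIdeal.ResidueField
        ((Module.Grassmannian.map (g.comp f) F).toSubmodule.map
          (t.baseChange p.asIdeal.ResidueField)) ≡ s [MOD 2] := by
      have := (hP.map f).spin p
      rwa [← Module.Grassmannian.map_comp, shiftOp_eq hE] at this
    by_cases hτ : g τ = 0
    · rw [hτ, biShear_zero, Submodule.map_id]
      exact hspin
    · rw [(H.baseChange_zero hE).finrank_raise ((hP.map (g.comp f)).isSpecialPair hE) hrE hτ]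
      exact (Nat.add_modEq_right).trans hspin

include H in
-- Here `F` stays constant, so the spin condition is inherited.
lemma isSplittingPair_lower (hϖ : algebraMap C K ϖ = 0)
    {F : G(n, (K ⊗[C] L); K)} {G : G(n + r, (K ⊗[C] L); K)}
    (hP : IsSplittingPair t b ϖ n r s F G) {w w' a a' : K ⊗[C] L}
    (hr : IsLowering (t.baseChange K) (b.baseChange K) F.toSubmodule G.toSubmodule w w' a a')
    {S : Type u} [CommRing S] [Algebra C S] (f : K →ₐ[C] S) (τ : S)
    {e : S ⊗[C] L ≃ₗ[S] S ⊗[C] L}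
    (he : e.toLinearMap = biShear (b.baseChange S) (f.toLinearMap.rTensor L w)
      (f.toLinearMap.rTensor L (t.baseChange K w')) (f.toLinearMap.rTensor L w')
      (f.toLinearMap.rTensor L (t.baseChange K w)) τ) :
    IsSplittingPair t b ϖ n r s (Module.Grassmannian.map f F)
      (grassmannianCongr e (Module.Grassmannian.map f G)) := by
  have hS := algebraMap_eq_zero_of_algHom f hϖ
  have hG : (grassmannianCongr e (Module.Grassmannian.map f G)).toSubmodule =
      (Module.Grassmannian.map f G).toSubmodule.map _ :=
    congrArg (Submodule.map · (Module.Grassmannian.map f G).toSubmodule) he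
  have hrS := hr.baseChange H hϖ (hP.isSpecialPair hϖ).map_eq_zero f
  rw [← grassmannian_map_toSubmodule, ← grassmannian_map_toSubmodule] at hrS
  refine IsSpecialPair.isSplittingPair hS ?_ (hP.map f).spin
  rw [hG, ← baseChange_rTensor, ← baseChange_rTensor]
  refine ((hP.map f).isSpecialPair hS).lower (fun x => ?_) hrS τ
  rw [(H.baseChange_zero hS).sq, zero_smul]

lemma aeval_zero_comp :
    ((Polynomial.aeval (0 : K)).restrictScalars C).comp
      ((Algebra.ofId K (Polynomial K)).restrictScalars C) = AlgHom.id C K := by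
  ext x
  simp [Algebra.ofId_apply]

lemma algebraMap_X_ne_zero :
    algebraMap (Polynomial K) (⊥ : PrimeSpectrum (Polynomial K)).asIdeal.ResidueField
      Polynomial.X ≠ 0 := by
  rw [Ne, Ideal.algebraMap_residueField_eq_zero]
  exact Polynomial.X_ne_zero

lemma grassmannian_map_congr_zero {k : ℕ} (N : G(k, (K ⊗[C] L); K)) {p q p' q' : K ⊗[C] L}
    {e : Polynomial K ⊗[C] L ≃ₗ[Polynomial K] Polynomial K ⊗[C] L}
    (he : e.toLinearMap = biShear (b.baseChange (Polynomial K))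
      (((Algebra.ofId K (Polynomial K)).restrictScalars C).toLinearMap.rTensor L p)
      (((Algebra.ofId K (Polynomial K)).restrictScalars C).toLinearMap.rTensor L q)
      (((Algebra.ofId K (Polynomial K)).restrictScalars C).toLinearMap.rTensor L p')
      (((Algebra.ofId K (Polynomial K)).restrictScalars C).toLinearMap.rTensor L q')
      Polynomial.X) :
    Module.Grassmannian.map ((Polynomial.aeval (0 : K)).restrictScalars C)
      (grassmannianCongr e (Module.Grassmannian.map
        ((Algebra.ofId K (Polynomial K)).restrictScalars C) N)) = N := by
  apply Module.Grassmannian.ext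
  rw [grassmannian_map_congr _ _ N he, aeval_zero_comp]
  have : ((Polynomial.aeval (0 : K)).restrictScalars C) (Polynomial.X : Polynomial K) = 0 := by
    simp
  rw [this, biShear_zero, Submodule.map_id]
  exact congrArg _ (Module.Grassmannian.map_id k (CommAlgCat.of C K) N)

lemma grassmannian_map_zero {k : ℕ} (N : G(k, (K ⊗[C] L); K)) :
    Module.Grassmannian.map ((Polynomial.aeval (0 : K)).restrictScalars C)
      (Module.Grassmannian.map ((Algebra.ofId K (Polynomial K)).restrictScalars C) N) = N := by
  rw [← Module.Grassmannian.map_comp, aeval_zero_comp]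
  exact Module.Grassmannian.map_id k (CommAlgCat.of C K) N

/-- The dimension of `G ∩ G^{⊥'}` over a field in which `ϖ` vanishes. -/
lemma lInvariant_eq {x : FieldPoint (splittingFunctor t b ϖ n r s)}
    (hϖ : algebraMap C x.K ϖ = 0) :
    lInvariant x = Module.finrank x.K (x.pt.1.2.toSubmodule ⊓
      ((b.baseChange x.K).orthogonal x.pt.1.2.toSubmodule).map (t.baseChange x.K) :
        Submodule x.K _) := by
  rw [lInvariant, modifiedPerp, shiftOp_neg_eq hϖ]

include H in
lemma two_mul_finrank_eq (hϖ : algebraMap C K ϖ = 0) (F : G(n, (K ⊗[C] L); K)) :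
    2 * Module.finrank K F.toSubmodule = 2 * n := by
  have := (H.baseChange_zero hϖ).finiteDimensional
  have h := finrank_grassmannian_add F
  rw [(H.baseChange_zero hϖ).finrank_eq] at h
  omega

/-- A splitting pair over a field as a point of the splitting functor. -/
def fieldPoint {F : G(n, (K ⊗[C] L); K)} {G : G(n + r, (K ⊗[C] L); K)}
    (hP : IsSplittingPair t b ϖ n r s F G) : FieldPoint (splittingFunctor t b ϖ n r s) :=
  ⟨K, ⟨(F, G), hP⟩⟩

/-- The generic fibre of a family over the affine line specializes to its fibre at the origin,
expressed through open sets of the point space. -/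
lemma mem_of_family {F : G(n, (K ⊗[C] L); K)} {G : G(n + r, (K ⊗[C] L); K)}
    (hP : IsSplittingPair t b ϖ n r s F G)
    {F' : G(n, (Polynomial K ⊗[C] L); Polynomial K)}
    {G' : G(n + r, (Polynomial K ⊗[C] L); Polynomial K)}
    (hP' : IsSplittingPair t b ϖ n r s F' G')
    (hF : Module.Grassmannian.map ((Polynomial.aeval (0 : K)).restrictScalars C) F' = F)
    (hG : Module.Grassmannian.map ((Polynomial.aeval (0 : K)).restrictScalars C) G' = G)
    {U : Set (PointSpace (splittingFunctor t b ϖ n r s))} (hU : IsOpen U)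
    (hx : PointSpace.mk (fieldPoint hP) ∈ U) :
    PointSpace.mk (fieldPoint (hP'.map (IsScalarTower.toAlgHom C (Polynomial K)
      (⊥ : PrimeSpectrum (Polynomial K)).asIdeal.ResidueField))) ∈ U := by
  subst hF hG
  exact PointSpace.specializes_of_family
    (M := splittingFunctor t b ϖ n r s) (K := K) ⟨(F', G'), hP'⟩ hU hx

lemma two_ne_zero_of_isUnit (h2 : IsUnit (2 : C)) : (2 : K) ≠ 0 := by
  have := (h2.map (algebraMap C K)).ne_zero
  rwa [map_ofNat] at this

include H in
/-- Every point with `h + 2 ≤ l` is a specialization of one with `h` raised by two. -/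
lemma exists_specialization_raise (h2 : IsUnit (2 : C)) (hϖ : algebraMap C K ϖ = 0)
    {F : G(n, (K ⊗[C] L); K)} {G : G(n + r, (K ⊗[C] L); K)}
    (hP : IsSplittingPair t b ϖ n r s F G)
    (hlt : Module.finrank K (F.toSubmodule.map (t.baseChange K)) + 2 ≤
      Module.finrank K (G.toSubmodule ⊓
        ((b.baseChange K).orthogonal G.toSubmodule).map (t.baseChange K) : Submodule K _)) :
    ∃ (E : Type u) (_ : Field E) (_ : Algebra C E) (f : K →ₐ[C] E) (F₁ : G(n, (E ⊗[C] L); E))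
      (hP₁ : IsSplittingPair t b ϖ n r s F₁ (Module.Grassmannian.map f G)),
      Module.finrank E (F₁.toSubmodule.map (t.baseChange E)) =
        Module.finrank K (F.toSubmodule.map (t.baseChange K)) + 2 ∧
      ∀ U : Set (PointSpace (splittingFunctor t b ϖ n r s)), IsOpen U →
        PointSpace.mk (fieldPoint hP) ∈ U → PointSpace.mk (fieldPoint hP₁) ∈ U := by
  have HK := H.baseChange_zero (R := K) hϖ
  obtain ⟨u, v, z, z', hr⟩ := HK.exists_raising (two_ne_zero_of_isUnit h2) (hP.isSpecialPair hϖ)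
    (two_mul_finrank_eq H hϖ F) hlt
  let c : K →ₐ[C] Polynomial K := (Algebra.ofId K (Polynomial K)).restrictScalars C
  have hr' := hr.baseChange c
  -- The coordinate `X` serves as shear parameter: zero at the origin, nonzero at the generic point.
  let e := biShearEquiv (((H.baseChange (Polynomial K)).symm _ _).trans hr'.uv) hr'.vv hr'.uu
    hr'.uv (Polynomial.X)
  have hPe := isSplittingPair_raise H hϖ hP hr c Polynomial.X (e := e) rfl
  let E := (⊥ : PrimeSpectrum (Polynomial K)).asIdeal.ResidueField
  let g : Polynomial K →ₐ[C] E := IsScalarTower.toAlgHom C _ _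
  have hE : algebraMap C E ϖ = 0 := algebraMap_eq_zero_of_algHom (g.comp c) hϖ
  have hrE := hr.baseChange (g.comp c)
  rw [← grassmannian_map_toSubmodule, ← grassmannian_map_toSubmodule] at hrE
  have hPE := hPe.map g
  have hX : g Polynomial.X ≠ 0 := algebraMap_X_ne_zero
  have hmem := fun U hU hx => mem_of_family hP hPe (grassmannian_map_congr_zero F (e := e) rfl)
    (grassmannian_map_zero G) (U := U) hU hx
  have hdim : Module.finrank E ((Module.Grassmannian.map g (grassmannianCongr e
      (Module.Grassmannian.map c F))).toSubmodule.map (t.baseChange E)) =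
        Module.finrank K (F.toSubmodule.map (t.baseChange K)) + 2 := by
    rw [grassmannian_map_congr c g F (e := e) rfl,
      (H.baseChange_zero hE).finrank_raise ((hP.map (g.comp c)).isSpecialPair hE) hrE hX,
      grassmannian_map_toSubmodule,
      map_span_rTensor _ (baseChange_rTensor t _), finrank_span_rTensor]
  -- The family `G` is constant, so its generic fibre is the base change of `G` along `K → E`; hence
  -- `l` is unchanged.
  have hG := Module.Grassmannian.map_comp _ c g G
  refine ⟨E, inferInstance, inferInstance, g.comp c, _, hG ▸ hPE, hdim, fun U hU hx => ?_⟩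
  convert hmem U hU hx using 3

include H in
/-- Every point with `h + 2 ≤ l` is a specialization of one with `l` lowered by two. -/
lemma exists_specialization_lower (h2 : IsUnit (2 : C)) (hϖ : algebraMap C K ϖ = 0)
    {F : G(n, (K ⊗[C] L); K)} {G : G(n + r, (K ⊗[C] L); K)}
    (hP : IsSplittingPair t b ϖ n r s F G)
    (hlt : Module.finrank K (F.toSubmodule.map (t.baseChange K)) + 2 ≤
      Module.finrank K (G.toSubmodule ⊓
        ((b.baseChange K).orthogonal G.toSubmodule).map (t.baseChange K) : Submodule K _)) :
    ∃ (E : Type u) (_ : Field E) (_ : Algebra C E) (f : K →ₐ[C] E)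
      (G₁ : G(n + r, (E ⊗[C] L); E))
      (hP₁ : IsSplittingPair t b ϖ n r s (Module.Grassmannian.map f F) G₁),
      Module.finrank E (G₁.toSubmodule ⊓
        ((b.baseChange E).orthogonal G₁.toSubmodule).map (t.baseChange E) : Submodule E _) + 2 =
      Module.finrank E ((Module.Grassmannian.map f G).toSubmodule ⊓
        ((b.baseChange E).orthogonal (Module.Grassmannian.map f G).toSubmodule).map
          (t.baseChange E) : Submodule E _) ∧
      ∀ U : Set (PointSpace (splittingFunctor t b ϖ n r s)), IsOpen U →
        PointSpace.mk (fieldPoint hP) ∈ U → PointSpace.mk (fieldPoint hP₁) ∈ U := by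
  have HK := H.baseChange_zero (R := K) hϖ
  obtain ⟨w, w', a, a', hr⟩ := HK.exists_lowering (two_ne_zero_of_isUnit h2)
    (hP.isSpecialPair hϖ) (two_mul_finrank_eq H hϖ F) hlt
  let c : K →ₐ[C] Polynomial K := (Algebra.ofId K (Polynomial K)).restrictScalars C
  have hG := (hP.isSpecialPair hϖ).map_eq_zero
  have hr' := hr.baseChange H hϖ hG c
  have k1 := hr'.wtw'
  have k2 := hr'.wtw
  have k3 := hr'.w'tw'
  have k4 := hr'.w'tw
  rw [baseChange_rTensor] at k1 k2 k3 k4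
  let e := biShearEquiv k1 k2 k3 k4 (Polynomial.X)
  have hPe := isSplittingPair_lower H hϖ hP hr c Polynomial.X (e := e) rfl
  let E := (⊥ : PrimeSpectrum (Polynomial K)).asIdeal.ResidueField
  let g : Polynomial K →ₐ[C] E := IsScalarTower.toAlgHom C _ _
  have hE : algebraMap C E ϖ = 0 := algebraMap_eq_zero_of_algHom (g.comp c) hϖ
  have hrE := hr.baseChange H hϖ hG (g.comp c)
  rw [← grassmannian_map_toSubmodule, ← grassmannian_map_toSubmodule] at hrE
  have hPE := hPe.map g
  have hmem := fun U hU hx => mem_of_family hP hPe (grassmannian_map_zero F)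
    (grassmannian_map_congr_zero G (e := e) rfl) (U := U) hU hx
  have hdim := (H.baseChange_zero hE).finrank_lower (two_ne_zero_of_isUnit h2)
    ((hP.map (g.comp c)).isSpecialPair hE) hrE algebraMap_X_ne_zero
  rw [baseChange_rTensor, baseChange_rTensor] at hdim
  have hG₁ := grassmannian_map_congr c g G (e := e) rfl
  have hF := Module.Grassmannian.map_comp _ c g F
  refine ⟨E, inferInstance, inferInstance, g.comp c, _, hF ▸ hPE, ?_, fun U hU hx => ?_⟩
  · rw [hG₁]
    exact hdim
  · convert hmem U hU hx using 3

end Families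

/-! ## Ranks of bilinear forms and minors -/

section Minors

variable {K V : Type*} [Field K] [AddCommGroup V] [Module K V]

/-- The vectors are taken from the generating set `S` itself: for a base changed submodule these
generators come from the original ring, so the minors do too. -/
lemma exists_linearIndependent_comp {W : Type*} [AddCommGroup W] [Module K W]
    [FiniteDimensional K W] (f : V →ₗ[K] W) (S : Set V) {k : ℕ}
    (hk : k ≤ Module.finrank K ((Submodule.span K S).map f)) :
    ∃ p : Fin k → V, (∀ i, p i ∈ S) ∧ LinearIndependent K (fun i => f (p i)) := by
  rw [Submodule.map_span] at hk
  obtain ⟨g, hg, -, hli⟩ := Submodule.exists_fun_fin_finrank_span_eq K (f '' S)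
  choose p hp hpg using hg
  refine ⟨fun i => p (Fin.castLE hk i), fun i => hp _, ?_⟩
  simp only [hpg]
  exact hli.comp _ (Fin.castLE_injective hk)

variable [FiniteDimensional K V]

/-- The map `x ↦ (b(x, q_j))_j` on `P` has rank `k` by the nonzero minor, and it kills `N`. -/
lemma finrank_add_le_of_det_ne_zero (b : LinearMap.BilinForm K V) {P N : Submodule K V}
    (hNP : N ≤ P) {k : ℕ} {p q : Fin k → V} (hp : ∀ i, p i ∈ P)
    (hN : ∀ x ∈ N, ∀ j, b x (q j) = 0)
    (hdet : (Matrix.of fun i j => b (p i) (q j)).det ≠ 0) :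
    Module.finrank K N + k ≤ Module.finrank K P := by
  let f : P →ₗ[K] Fin k → K := LinearMap.pi fun j => (b.flip (q j)).domRestrict P
  have hli : LinearIndependent K (fun i => f ⟨p i, hp i⟩) := by
    have := Matrix.linearIndependent_rows_iff_isUnit.2
      ((Matrix.isUnit_iff_isUnit_det _).2 (isUnit_iff_ne_zero.2 hdet))
    exact this
  have h1 : k ≤ Module.finrank K (LinearMap.range f) := by
    have h2 := finrank_span_eq_card hli
    rw [Fintype.card_fin] at h2
    refine h2.symm.le.trans (Submodule.finrank_mono ?_)
    rw [Submodule.span_le]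
    rintro _ ⟨i, rfl⟩
    exact ⟨_, rfl⟩
  have h2 : N.comap P.subtype ≤ LinearMap.ker f := fun x hx => by
    ext j
    exact hN x hx j
  have h3 := Submodule.finrank_mono h2
  rw [(Submodule.comapSubtypeEquivOfLe hNP).finrank_eq] at h3
  have := LinearMap.finrank_range_add_finrank_ker f
  omega

/-- The map from `P` to the dual of `Q` has rank at least `k`. Generators `p_i` giving independent
functionals on `Q` are chosen there; these functionals then map `Q` onto `K^k`, which supplies the
`q_j`. -/
lemma exists_det_ne_zero (b : LinearMap.BilinForm K V) {SP SQ : Set V} {N : Submodule K V}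
    (hN : ∀ x ∈ Submodule.span K SP, (∀ y ∈ Submodule.span K SQ, b x y = 0) → x ∈ N)
    {k : ℕ} (hk : Module.finrank K N + k ≤ Module.finrank K (Submodule.span K SP)) :
    ∃ p q : Fin k → V, (∀ i, p i ∈ SP) ∧ (∀ i, q i ∈ SQ) ∧
      (Matrix.of fun i j => b (p i) (q j)).det ≠ 0 := by
  set P := Submodule.span K SP
  set Q := Submodule.span K SQ
  let f : V →ₗ[K] Module.Dual K Q := Q.subtype.dualMap ∘ₗ b
  have hf : ∀ x (y : Q), f x y = b x y := fun x y => rfl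
  obtain ⟨p, hp, hli⟩ := exists_linearIndependent_comp f SP (k := k) (by
    have h1 := LinearMap.finrank_range_add_finrank_ker (f.domRestrict P)
    rw [LinearMap.range_domRestrict] at h1
    have h2 : (LinearMap.ker (f.domRestrict P)).map P.subtype ≤ N := by
      rintro _ ⟨x, hx, rfl⟩
      exact hN x x.2 fun y hy => LinearMap.congr_fun (LinearMap.mem_ker.1 hx) ⟨y, hy⟩
    have h3 := Submodule.finrank_mono h2
    rw [Submodule.finrank_map_subtype_eq] at h3
    change k ≤ Module.finrank K (P.map f)
    omega)
  let g : V →ₗ[K] Fin k → K := LinearMap.pi fun i => b (p i)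
  have hg : Q.map g = ⊤ := by
    by_contra hne
    obtain ⟨x, hx⟩ := SetLike.exists_not_mem_of_ne_top _ hne rfl
    obtain ⟨ψ, h1, h2⟩ := Submodule.exists_le_ker_of_notMem hx
    have hψ : ∀ y : Fin k → K, ψ y = ∑ i, ψ (Pi.single i 1) * y i := by
      intro y
      conv_lhs => rw [← Finset.univ_sum_single y, map_sum]
      refine Finset.sum_congr rfl fun i _ => ?_
      rw [mul_comm, ← smul_eq_mul, ← map_smul, ← Pi.single_smul, smul_eq_mul, mul_one]
    have h3 := Fintype.linearIndependent_iff.1 hli (fun i => ψ (Pi.single i 1)) (by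
      ext y
      have h4 : ψ (g y) = 0 := h2 ⟨y, y.2, rfl⟩
      rw [hψ] at h4
      simpa [hf, g] using h4)
    exact h1 (by rw [hψ]; simp [h3])
  obtain ⟨q, hq, hli'⟩ := exists_linearIndependent_comp g SQ (k := k) (by
    change k ≤ Module.finrank K (Q.map g)
    rw [hg, finrank_top, Module.finrank_fin_fun])
  refine ⟨p, q, hp, hq, ?_⟩
  have h5 : LinearIndependent K (Matrix.of fun i j => b (p i) (q j)).col := hli'
  rw [Matrix.linearIndependent_cols_iff_isUnit, Matrix.isUnit_iff_isUnit_det] at h5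
  exact h5.ne_zero

end Minors

/-! ### Semicontinuity of the two dimensions and invariance under field extension. -/

section Semicontinuity

variable {C : Type u} [CommRing C] {L : Type u} [AddCommGroup L] [Module C L]
  {t : L →ₗ[C] L} {b : LinearMap.BilinForm C L} {ϖ : C} {n r s : ℕ}

lemma det_rTensor {R S : Type u} [CommRing R] [Algebra C R] [CommRing S] [Algebra C S]
    (f : R →ₐ[C] S) {k : ℕ} (p q : Fin k → R ⊗[C] L) :
    (Matrix.of fun i j => b.baseChange S (f.toLinearMap.rTensor L (p i))
      (f.toLinearMap.rTensor L (q j))).det =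
      f (Matrix.of fun i j => b.baseChange R (p i) (q j)).det := by
  rw [AlgHom.map_det]
  congr 1
  ext i j
  simp [baseChange_form_rTensor]

/-- The rank of the pairing of two base changed submodules is detected by minors. -/
lemma finrank_add_le_iff_exists_det {R E : Type u} [CommRing R] [Algebra C R] [Field E]
    [Algebra C E] [FiniteDimensional E (E ⊗[C] L)] (f : R →ₐ[C] E) (P Q : Submodule R (R ⊗[C] L))
    {N : Submodule E (E ⊗[C] L)}
    (hN : ∀ x, x ∈ N ↔ x ∈ Submodule.span E (f.toLinearMap.rTensor L '' P) ∧
      ∀ y ∈ Submodule.span E (f.toLinearMap.rTensor L '' Q), b.baseChange E x y = 0) (k : ℕ) :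
    Module.finrank E N + k ≤ Module.finrank E (Submodule.span E (f.toLinearMap.rTensor L '' P)) ↔
      ∃ p q : Fin k → R ⊗[C] L, (∀ i, p i ∈ P) ∧ (∀ i, q i ∈ Q) ∧
        f (Matrix.of fun i j => b.baseChange R (p i) (q j)).det ≠ 0 := by
  constructor
  · intro h
    obtain ⟨p, q, hp, hq, hdet⟩ := exists_det_ne_zero (b.baseChange E)
      (fun x hx hx' => (hN x).2 ⟨hx, hx'⟩) h
    choose p hp hp' using hp
    choose q hq hq' using hq
    refine ⟨p, q, hp, hq, ?_⟩
    rw [← det_rTensor]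
    simpa only [hp', hq'] using hdet
  · rintro ⟨p, q, hp, hq, hdet⟩
    rw [← det_rTensor] at hdet
    exact finrank_add_le_of_det_ne_zero (b.baseChange E) (fun x hx => ((hN x).1 hx).1)
      (fun i => Submodule.subset_span ⟨_, hp i, rfl⟩)
      (fun x hx j => ((hN x).1 hx).2 _ (Submodule.subset_span ⟨_, hq j, rfl⟩)) hdet

/-- The set is a union of the basic open sets of all minors. -/
lemma isOpen_exists_det {R : Type u} [CommRing R] [Algebra C R] (P Q : Submodule R (R ⊗[C] L))
    (k : ℕ) : IsOpen {x : PrimeSpectrum R | ∃ p q : Fin k → R ⊗[C] L,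
      (∀ i, p i ∈ P) ∧ (∀ i, q i ∈ Q) ∧ IsScalarTower.toAlgHom C R x.asIdeal.ResidueField
        (Matrix.of fun i j => b.baseChange R (p i) (q j)).det ≠ 0} := by
  have : {x : PrimeSpectrum R | ∃ p q : Fin k → R ⊗[C] L,
      (∀ i, p i ∈ P) ∧ (∀ i, q i ∈ Q) ∧ IsScalarTower.toAlgHom C R x.asIdeal.ResidueField
        (Matrix.of fun i j => b.baseChange R (p i) (q j)).det ≠ 0} =
      ⋃ (p : Fin k → P) (q : Fin k → Q), (PrimeSpectrum.basicOpen
        (Matrix.of fun i j => b.baseChange R (p i : R ⊗[C] L) (q j : R ⊗[C] L)).det :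
          Set (PrimeSpectrum R)) := by
    ext x
    have hx : ∀ a : R, IsScalarTower.toAlgHom C R x.asIdeal.ResidueField a = 0 ↔ a ∈ x.asIdeal :=
      fun a => Ideal.algebraMap_residueField_eq_zero
    simp only [Set.mem_ofPred_eq, Set.mem_iUnion, SetLike.mem_coe, PrimeSpectrum.mem_basicOpen,
      ne_eq, hx]
    constructor
    · rintro ⟨p, q, hp, hq, h⟩
      exact ⟨fun i => ⟨p i, hp i⟩, fun i => ⟨q i, hq i⟩, h⟩
    · rintro ⟨p, q, h⟩
      exact ⟨fun i => p i, fun i => q i, fun i => (p i).2, fun i => (q i).2, h⟩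
  rw [this]
  exact isOpen_iUnion fun p => isOpen_iUnion fun q => (PrimeSpectrum.basicOpen _).2

variable (H : IsDualLattice t b (ϖ ^ 2) (2 * n))
include H

/-- Pairing with the whole space has trivial left kernel, so the rank criterion by minors measures
the dimension of `P` itself; it is applied to `P = tF`. -/
lemma mem_bot_iff_span {R E : Type u} [CommRing R] [Algebra C R] [Field E] [Algebra C E]
    (hE : algebraMap C E ϖ = 0) (f : R →ₐ[C] E) (P : Submodule R (R ⊗[C] L))
    (x : E ⊗[C] L) : x ∈ (⊥ : Submodule E (E ⊗[C] L)) ↔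
      x ∈ Submodule.span E (f.toLinearMap.rTensor L '' P) ∧
      ∀ y ∈ Submodule.span E (f.toLinearMap.rTensor L '' ((⊤ : Submodule R (R ⊗[C] L)) : Set _)),
        b.baseChange E x y = 0 := by
  rw [span_range_rTensor, Submodule.mem_bot]
  constructor
  · rintro rfl
    exact ⟨Submodule.zero_mem _, by simp⟩
  · rintro ⟨-, h⟩
    exact (H.baseChange_zero hE).eq_zero fun y => h y trivial

lemma mem_inf_map_orthogonal_iff_span {R E : Type u} [CommRing R] [Algebra C R] [Field E]
    [Algebra C E] (hϖ : algebraMap C R ϖ = 0) (f : R →ₐ[C] E) {G : Submodule R (R ⊗[C] L)}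
    (hG : ∀ g ∈ G, t.baseChange R g = 0) (x : E ⊗[C] L) :
    x ∈ (Submodule.span E (f.toLinearMap.rTensor L '' G) ⊓
        ((b.baseChange E).orthogonal (Submodule.span E (f.toLinearMap.rTensor L '' G))).map
          (t.baseChange E) : Submodule E _) ↔
      x ∈ Submodule.span E (f.toLinearMap.rTensor L '' G) ∧
      ∀ y ∈ Submodule.span E (f.toLinearMap.rTensor L '' (G.comap (t.baseChange R))),
        b.baseChange E x y = 0 := by
  rw [Submodule.mem_inf, ← comap_span_rTensor H hϖ f hG,
    (H.baseChange_zero (algebraMap_eq_zero_of_algHom f hϖ)).mem_map_orthogonal_iff]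
  · rfl
  · intro y hy
    have h1 : t.baseChange E y ∈
      (Submodule.span E (f.toLinearMap.rTensor L '' G)).map (t.baseChange E) := ⟨y, hy, rfl⟩
    rw [map_span_rTensor f (baseChange_rTensor t f)] at h1
    have h2 : G.map (t.baseChange R) = ⊥ := by
      rw [eq_bot_iff]
      rintro _ ⟨g, hg, rfl⟩
      exact hG g hg
    rw [h2] at h1
    simpa using h1

/-- The dimension of `G ∩ G^{⊥'}` is invariant under field extensions. -/
lemma finrank_inf_map_orthogonal_span {K E : Type u} [Field K] [Algebra C K] [Field E]
    [Algebra C E] (hϖ : algebraMap C K ϖ = 0) (f : K →ₐ[C] E) {G : Submodule K (K ⊗[C] L)}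
    (hG : ∀ g ∈ G, t.baseChange K g = 0) :
    Module.finrank E (Submodule.span E (f.toLinearMap.rTensor L '' G) ⊓
        ((b.baseChange E).orthogonal (Submodule.span E (f.toLinearMap.rTensor L '' G))).map
          (t.baseChange E) : Submodule E _) =
      Module.finrank K (G ⊓ ((b.baseChange K).orthogonal G).map (t.baseChange K) :
        Submodule K _) := by
  have hE := algebraMap_eq_zero_of_algHom f hϖ
  have := (H.baseChange_zero hϖ).finiteDimensional
  have := (H.baseChange_zero hE).finiteDimensional
  have key := fun k => finrank_add_le_iff_exists_det f G (G.comap (t.baseChange K))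
    (mem_inf_map_orthogonal_iff_span H hϖ f hG) k
  have hid : Submodule.span K ((AlgHom.id C K).toLinearMap.rTensor L '' G) = G := by
    simp [AlgHom.toLinearMap_id, LinearMap.rTensor_id]
  have hN := mem_inf_map_orthogonal_iff_span H hϖ (AlgHom.id C K) hG
  rw [hid] at hN
  have key' := fun k => finrank_add_le_iff_exists_det (AlgHom.id C K) G
    (G.comap (t.baseChange K)) (fun x => by rw [hid]; exact hN x) k
  rw [hid] at key'
  rw [finrank_span_rTensor] at key
  -- The same minors over `K` govern both sides, and a map of fields preserves their nonvanishing.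
  have hiff := fun k => (key k).trans (Iff.trans (by
    simp only [ne_eq, map_eq_zero, AlgHom.coe_id, id_eq]) (key' k).symm)
  have l1 : Module.finrank E (Submodule.span E (f.toLinearMap.rTensor L '' G) ⊓
        ((b.baseChange E).orthogonal (Submodule.span E (f.toLinearMap.rTensor L '' G))).map
          (t.baseChange E) : Submodule E _) ≤ Module.finrank K G := by
    rw [← finrank_span_rTensor f]
    exact Submodule.finrank_mono inf_le_left
  have l2 : Module.finrank K (G ⊓ ((b.baseChange K).orthogonal G).map (t.baseChange K) :
        Submodule K _) ≤ Module.finrank K G := Submodule.finrank_mono inf_le_left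
  -- Taking for `k` the exact codimension on either side gives the two inequalities.
  have m1 := (hiff (Module.finrank K G - _)).1 (Nat.add_sub_of_le l1).le
  have m2 := (hiff (Module.finrank K G - _)).2 (Nat.add_sub_of_le l2).le
  omega

end Semicontinuity

/-! ## Strata of the special fiber of a splitting functor -/

namespace SplittingSpace

open PointSpace

variable {C : Type u} [CommRing C] {L : Type u} [AddCommGroup L] [Module C L]
  {t : L →ₗ[C] L} {b : LinearMap.BilinForm C L} {ϖ : C} {n r s : ℕ}

/-- The function `dim t F` on the underlying space. -/
noncomputable def hFun : PointSpace (splittingFunctor t b ϖ n r s) → ℕ :=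
  Quot.lift hInvariant (by
    rintro ⟨K, ⟨⟨F, G⟩, hP⟩⟩ ⟨E, P⟩ ⟨f, hf⟩
    change K →ₐ[C] E at f
    replace hf : P = (splittingFunctor t b ϖ n r s).map (CommAlgCat.ofHom f) ⟨(F, G), hP⟩ :=
      hf.symm
    subst hf
    change Module.finrank K (F.toSubmodule.map (t.baseChange K)) = Module.finrank E
      ((Module.Grassmannian.map f F).toSubmodule.map (t.baseChange E))
    rw [grassmannian_map_toSubmodule, map_span_rTensor _ (baseChange_rTensor t _),
      finrank_span_rTensor])

variable (H : IsDualLattice t b (ϖ ^ 2) (2 * n))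

include H in
lemma lInvariant_eq_of_algHom {x y : FieldPoint (splittingFunctor t b ϖ n r s)}
    (hϖ : algebraMap C x.K ϖ = 0) (f : x.K →ₐ[C] y.K)
    (hf : (splittingFunctor t b ϖ n r s).map (CommAlgCat.ofHom f) x.pt = y.pt) :
    lInvariant x = lInvariant y := by
  rw [lInvariant_eq hϖ, lInvariant_eq (algebraMap_eq_zero_of_algHom f hϖ), ← hf]
  obtain ⟨K, ⟨⟨F, G⟩, hP⟩⟩ := x
  obtain ⟨E, P⟩ := y
  have h := finrank_inf_map_orthogonal_span H hϖ f (hP.isSpecialPair hϖ).map_eq_zero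
  rw [← grassmannian_map_toSubmodule] at h
  exact h.symm

open Classical in
/-- The function `dim (G ∩ G^{⊥'})` on the special fiber, extended by zero. -/
noncomputable def lFun : PointSpace (splittingFunctor t b ϖ n r s) → ℕ :=
  Quot.lift (fun x => if algebraMap C x.K ϖ = 0 then lInvariant x else 0) (by
    rintro x y ⟨f, hf⟩
    have h : algebraMap C x.K ϖ = 0 ↔ algebraMap C y.K ϖ = 0 := by
      rw [← f.commutes]
      exact (map_eq_zero f.toRingHom).symm
    by_cases hx : algebraMap C x.K ϖ = 0
    · rw [if_pos hx, if_pos (h.1 hx)]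
      exact lInvariant_eq_of_algHom H hx f hf
    · rw [if_neg hx, if_neg fun hy => hx (h.2 hy)])

lemma lFun_fieldPoint {K : Type u} [Field K] [Algebra C K] (hϖ : algebraMap C K ϖ = 0)
    {F : G(n, (K ⊗[C] L); K)} {G : G(n + r, (K ⊗[C] L); K)}
    (hP : IsSplittingPair t b ϖ n r s F G) :
    lFun H (mk (fieldPoint hP)) = Module.finrank K (G.toSubmodule ⊓
      ((b.baseChange K).orthogonal G.toSubmodule).map (t.baseChange K) : Submodule K _) :=
  (if_pos hϖ).trans (lInvariant_eq (x := fieldPoint hP) hϖ)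

lemma lFun_mk {x : FieldPoint (splittingFunctor t b ϖ n r s)} (hϖ : algebraMap C x.K ϖ = 0) :
    lFun H (mk x) = lInvariant x := if_pos hϖ

variable (t b ϖ n r s) in
/-- The special fiber of the underlying space. -/
def fiber : Set (PointSpace (splittingFunctor t b ϖ n r s)) :=
  {P | ∃ x : FieldPoint (splittingFunctor t b ϖ n r s), mk x = P ∧ algebraMap C x.K ϖ = 0}

lemma mem_fiber_iff {P : PointSpace (splittingFunctor t b ϖ n r s)} :
    P ∈ fiber t b ϖ n r s ↔ Vanishes ϖ P := by
  constructor
  · rintro ⟨x, rfl, hx⟩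
    exact hx
  · intro h
    obtain ⟨x, rfl⟩ := exists_mk_eq P
    exact ⟨x, rfl, h⟩

variable (t b ϖ n r s) in
/-- The strata of the special fiber. -/
def strata (h l : ℕ) : Set (fiber t b ϖ n r s) :=
  {P | ∃ x : FieldPoint (splittingFunctor t b ϖ n r s),
    mk x = P.1 ∧ hInvariant x = h ∧ lInvariant x = l}

lemma mem_strata_iff {h l : ℕ} {P : fiber t b ϖ n r s} :
    P ∈ strata t b ϖ n r s h l ↔ hFun P.1 = h ∧ lFun H P.1 = l := by
  have hP := mem_fiber_iff.1 P.2
  constructor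
  · rintro ⟨x, hx, rfl, rfl⟩
    rw [← hx] at hP ⊢
    exact ⟨rfl, lFun_mk H hP⟩
  · rintro ⟨rfl, rfl⟩
    obtain ⟨x, hx⟩ := exists_mk_eq P.1
    rw [← hx] at hP
    exact ⟨x, hx, by rw [← hx]; rfl, by rw [← hx]; exact (lFun_mk H hP).symm⟩

variable (hrs : r + s = n)
include hrs

include H in
lemma finrank_eq_of_grassmannian {K : Type u} [Field K] [Algebra C K]
    (hϖ : algebraMap C K ϖ = 0) (G : G(n + r, (K ⊗[C] L); K)) :
    Module.finrank K G.toSubmodule = s := by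
  have := (H.baseChange_zero hϖ).finiteDimensional
  have h := finrank_grassmannian_add G
  rw [(H.baseChange_zero hϖ).finrank_eq] at h
  omega

/-- The constraints satisfied by the invariants of a point of the special fiber. -/
lemma invariants_of_mem_fiber (h2 : IsUnit (2 : C)) {P : PointSpace (splittingFunctor t b ϖ n r s)}
    (hP : P ∈ fiber t b ϖ n r s) :
    lFun H P ≤ s ∧ hFun P ≡ s [MOD 2] ∧ lFun H P ≡ s [MOD 2] := by
  obtain ⟨x, rfl, hϖ⟩ := hP
  rw [lFun_mk H hϖ, lInvariant_eq hϖ]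
  obtain ⟨K, ⟨⟨F, G⟩, hP⟩⟩ := x
  have hK : algebraMap C K ϖ = 0 := hϖ
  have HK := H.baseChange_zero hK
  have := HK.finiteDimensional
  have hG := finrank_eq_of_grassmannian H hrs hK G
  refine ⟨?_, ?_, ?_⟩
  · conv_rhs => rw [← hG]
    exact Submodule.finrank_mono inf_le_left
  -- The spectrum of `K` has one point, and passing to its residue field does not change the rank.
  · have h := hP.spin ⊥
    rw [shiftOp_eq (algebraMap_eq_zero_of_algHom (IsScalarTower.toAlgHom C K _) hK),
      grassmannian_map_toSubmodule, map_span_rTensor _ (baseChange_rTensor t _),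
      finrank_span_rTensor] at h
    exact h
  · conv_rhs => rw [← hG]
    exact HK.finrank_inf_modEq (two_ne_zero_of_isUnit h2) (hP.isSpecialPair hK).map_eq_zero

omit hrs in
include H in
lemma isClosed_hFun_le {R : Type u} [CommRing R] [Algebra C R] (hϖ : algebraMap C R ϖ = 0)
    (ξ : (splittingFunctor t b ϖ n r s).obj (CommAlgCat.of C R)) (h : ℕ) :
    IsClosed {p : PrimeSpectrum R | hFun (ofPoint ξ p) ≤ h} := by
  obtain ⟨⟨F, G⟩, hP⟩ := ξ
  rw [← isOpen_compl_iff]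
  convert isOpen_exists_det (b := b) (F.toSubmodule.map (t.baseChange R)) ⊤ (h + 1) using 1
  ext p
  let f := IsScalarTower.toAlgHom C R p.asIdeal.ResidueField
  have hE := algebraMap_eq_zero_of_algHom f hϖ
  have := (H.baseChange_zero hE).finiteDimensional
  refine Iff.trans ?_ (finrank_add_le_iff_exists_det f _ _ (mem_bot_iff_span H hE f _) (h + 1))
  rw [← map_span_rTensor f (baseChange_rTensor t f), ← grassmannian_map_toSubmodule, finrank_bot,
    zero_add]
  exact not_le (α := ℕ)

/-- Since `G` has constant rank `s`, the dimension of the radical is at least `l` exactly when the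
pairing `G × t⁻¹(G)` has rank at most `s - l`. -/
lemma isClosed_le_lFun {R : Type u} [CommRing R] [Algebra C R] (hϖ : algebraMap C R ϖ = 0)
    (ξ : (splittingFunctor t b ϖ n r s).obj (CommAlgCat.of C R)) {l : ℕ} (hl : l ≤ s) :
    IsClosed {p : PrimeSpectrum R | l ≤ lFun H (ofPoint ξ p)} := by
  obtain ⟨⟨F, G⟩, hP⟩ := ξ
  have hG := (hP.isSpecialPair hϖ).map_eq_zero
  rw [← isOpen_compl_iff]
  convert isOpen_exists_det (b := b) G.toSubmodule (G.toSubmodule.comap (t.baseChange R))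
    -- The complement requires rank at least `s - l + 1`; `l ≤ s` keeps the natural subtraction
    -- exact.
    (s - l + 1) using 1
  ext p
  let f := IsScalarTower.toAlgHom C R p.asIdeal.ResidueField
  have hE := algebraMap_eq_zero_of_algHom f hϖ
  have := (H.baseChange_zero hE).finiteDimensional
  refine Iff.trans ?_ (finrank_add_le_iff_exists_det f _ _
    (mem_inf_map_orthogonal_iff_span H hϖ f hG) (s - l + 1))
  rw [← grassmannian_map_toSubmodule, finrank_eq_of_grassmannian H hrs hE]
  have h1 := lFun_fieldPoint H hE (hP.map f)
  change ¬ (l ≤ lFun H (mk (fieldPoint (hP.map f)))) ↔ _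
  rw [h1]
  omega

/-- The description by minors is valid only where `ϖ` vanishes, so for each test ring `R` closedness
is proved over `R / ϖ` and transported along the closed embedding of spectra. -/
lemma isClosed_region (h : ℕ) {l : ℕ} (hl : l ≤ s) :
    IsClosed {P : PointSpace (splittingFunctor t b ϖ n r s) |
      Vanishes ϖ P ∧ hFun P ≤ h ∧ l ≤ lFun H P} := by
  rw [← isOpen_compl_iff, isOpen_iff]
  intro R _ _ ξ
  rw [Set.preimage_compl, isOpen_compl_iff]
  let I : Ideal R := Ideal.span {algebraMap C R ϖ}
  let q : R →ₐ[C] R ⧸ I := Ideal.Quotient.mkₐ C I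
  have hq : algebraMap C (R ⧸ I) ϖ = 0 :=
    Ideal.Quotient.eq_zero_iff_mem.2 (Ideal.mem_span_singleton_self _)
  have hqs : Function.Surjective q.toRingHom := Ideal.Quotient.mk_surjective
  have hcl := PrimeSpectrum.isClosedEmbedding_comap_of_surjective _ q.toRingHom hqs
  have hset : ofPoint ξ ⁻¹' {P : PointSpace (splittingFunctor t b ϖ n r s) |
      Vanishes ϖ P ∧ hFun P ≤ h ∧ l ≤ lFun H P} =
      PrimeSpectrum.comap q.toRingHom ''
        ({p | hFun (ofPoint ((splittingFunctor t b ϖ n r s).map (CommAlgCat.ofHom q) ξ) p) ≤ h} ∩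
        {p | l ≤ lFun H (ofPoint ((splittingFunctor t b ϖ n r s).map (CommAlgCat.ofHom q) ξ) p)}) := by
    ext p
    constructor
    · rintro ⟨h1, h2, h3⟩
      rw [vanishes_ofPoint] at h1
      have hp : p ∈ Set.range (PrimeSpectrum.comap q.toRingHom) := by
        rw [range_comap_of_surjective _ q.toRingHom hqs, PrimeSpectrum.mem_zeroLocus]
        intro a ha
        have ha' : a ∈ I := Ideal.Quotient.eq_zero_iff_mem.1 ha
        exact (Ideal.span_singleton_le_iff_mem _).2 h1 ha'
      obtain ⟨p', rfl⟩ := hp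
      rw [← ofPoint_map] at h2 h3
      exact ⟨p', ⟨h2, h3⟩, rfl⟩
    · rintro ⟨p', ⟨h2, h3⟩, rfl⟩
      simp only [Set.mem_ofPred_eq, ofPoint_map] at h2 h3
      refine ⟨?_, h2, h3⟩
      rw [← ofPoint_map, vanishes_ofPoint, hq]
      exact Ideal.zero_mem _
  rw [hset]
  exact hcl.isClosedMap _ ((isClosed_hFun_le H hq _ h).inter (isClosed_le_lFun H hrs hq _ hl))

omit hrs in
lemma exists_raise (h2 : IsUnit (2 : C)) {P : fiber t b ϖ n r s}
    (hP : hFun P.1 + 2 ≤ lFun H P.1) : ∃ P' : fiber t b ϖ n r s, P' ⤳ P ∧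
      hFun P'.1 = hFun P.1 + 2 ∧ lFun H P'.1 = lFun H P.1 := by
  obtain ⟨P, hPf⟩ := P
  obtain ⟨⟨K, ⟨⟨F, G⟩, hp⟩⟩, rfl⟩ := exists_mk_eq P
  have hK : algebraMap C K ϖ = 0 := mem_fiber_iff.1 hPf
  have hl := lFun_fieldPoint H hK hp
  obtain ⟨E, _, _, f, F₁, hP₁, hdim, hspec⟩ :=
    exists_specialization_raise H h2 hK hp (hP.trans_eq hl)
  have hE := algebraMap_eq_zero_of_algHom f hK
  refine ⟨⟨mk (fieldPoint hP₁), mem_fiber_iff.2 hE⟩, ?_, hdim, ?_⟩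
  · exact Topology.IsInducing.subtypeVal.specializes_iff.1 (specializes_iff_forall_open.2 hspec)
  · refine Eq.trans ?_ hl.symm
    rw [lFun_fieldPoint H hE,
      ← finrank_inf_map_orthogonal_span H hK f (hp.isSpecialPair hK).map_eq_zero,
      ← grassmannian_map_toSubmodule]

omit hrs in
lemma exists_lower (h2 : IsUnit (2 : C)) {P : fiber t b ϖ n r s}
    (hP : hFun P.1 + 2 ≤ lFun H P.1) : ∃ P' : fiber t b ϖ n r s, P' ⤳ P ∧
      hFun P'.1 = hFun P.1 ∧ lFun H P'.1 + 2 = lFun H P.1 := by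
  obtain ⟨P, hPf⟩ := P
  obtain ⟨⟨K, ⟨⟨F, G⟩, hp⟩⟩, rfl⟩ := exists_mk_eq P
  have hK : algebraMap C K ϖ = 0 := mem_fiber_iff.1 hPf
  have hl := lFun_fieldPoint H hK hp
  obtain ⟨E, _, _, f, G₁, hP₁, hdim, hspec⟩ :=
    exists_specialization_lower H h2 hK hp (hP.trans_eq hl)
  have hE := algebraMap_eq_zero_of_algHom f hK
  refine ⟨⟨mk (fieldPoint hP₁), mem_fiber_iff.2 hE⟩, ?_, ?_, ?_⟩
  · exact Topology.IsInducing.subtypeVal.specializes_iff.1 (specializes_iff_forall_open.2 hspec)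
  · change Module.finrank E ((Module.Grassmannian.map f F).toSubmodule.map (t.baseChange E)) =
      Module.finrank K (F.toSubmodule.map (t.baseChange K))
    rw [grassmannian_map_toSubmodule, map_span_rTensor _ (baseChange_rTensor t _),
      finrank_span_rTensor]
  · refine Eq.trans ?_ hl.symm
    rw [lFun_fieldPoint H hE,
      ← finrank_inf_map_orthogonal_span H hK f (hp.isSpecialPair hK).map_eq_zero,
      ← grassmannian_map_toSubmodule]
    exact hdim

omit hrs in
-- Here `d` counts raisings of `h` and `e` lowerings of `l`. All raisings precede the lowerings, and
-- `h ≤ l` leaves the gap of two that each step needs.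
lemma mem_closure_strata (h2 : IsUnit (2 : C)) {h l : ℕ} (hhl : h ≤ l) (d e : ℕ)
    (P : fiber t b ϖ n r s) (hh : hFun P.1 + 2 * d = h) (hl : l + 2 * e = lFun H P.1) :
    P ∈ closure (strata t b ϖ n r s h l) := by
  induction d generalizing P with
  | zero =>
    induction e generalizing P with
    | zero => exact subset_closure ((mem_strata_iff H).2 ⟨hh, hl.symm⟩)
    | succ e ih =>
      obtain ⟨P', hs, h1, h3⟩ := exists_lower H h2 (P := P) (by omega)
      exact hs.mem_closed isClosed_closure (ih P' (by omega) (by omega))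
  | succ d ih =>
    obtain ⟨P', hs, h1, h3⟩ := exists_raise H h2 (P := P) (by omega)
    exact hs.mem_closed isClosed_closure (ih P' (by omega) (by omega))

include H in
/-- The closure relations between the strata of the special fiber of a splitting functor. -/
theorem closure_strata (h2 : IsUnit (2 : C)) {h l : ℕ} (hhl : h ≤ l) (hls : l ≤ s)
    (hh : h ≡ s [MOD 2]) (hl : l ≡ s [MOD 2]) :
    closure (strata t b ϖ n r s h l) =
      ⋃ q ∈ {q : ℕ × ℕ | q.1 ≤ h ∧ l ≤ q.2 ∧ q.2 ≤ s ∧ q.1 ≡ s [MOD 2] ∧ q.2 ≡ s [MOD 2]},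
        strata t b ϖ n r s q.1 q.2 := by
  apply Set.Subset.antisymm
  · intro P hP
    have hcl : IsClosed (Subtype.val ⁻¹' {P : PointSpace (splittingFunctor t b ϖ n r s) |
        Vanishes ϖ P ∧ hFun P ≤ h ∧ l ≤ lFun H P} : Set (fiber t b ϖ n r s)) :=
      (isClosed_region H hrs h hls).preimage continuous_subtype_val
    have hsub := closure_minimal (s := strata t b ϖ n r s h l) (fun Q hQ => by
      obtain ⟨h1, h3⟩ := (mem_strata_iff H).1 hQ
      exact ⟨mem_fiber_iff.1 Q.2, h1.le, h3.ge⟩) hcl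
    obtain ⟨-, h1, h3⟩ := hsub hP
    obtain ⟨i1, i2, i3⟩ := invariants_of_mem_fiber H hrs h2 P.2
    rw [Set.mem_iUnion₂]
    exact ⟨(hFun P.1, lFun H P.1), ⟨h1, h3, i1, i2, i3⟩, (mem_strata_iff H).2 ⟨rfl, rfl⟩⟩
  · intro P hP
    rw [Set.mem_iUnion₂] at hP
    obtain ⟨⟨h', l'⟩, ⟨q1, q2, q3, q4, q5⟩, hP⟩ := hP
    obtain ⟨h1, h3⟩ := (mem_strata_iff H).1 hP
    simp only [Nat.ModEq] at *
    -- The congruences modulo two make both halves exact.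
    exact mem_closure_strata H h2 hhl ((h - h') / 2) ((l' - l) / 2) P (by omega) (by omega)

omit hrs in
include H in
lemma disjoint_strata {h l h' l' : ℕ} (hne : (h, l) ≠ (h', l')) :
    Disjoint (strata t b ϖ n r s h l) (strata t b ϖ n r s h' l') := by
  rw [Set.disjoint_left]
  intro P hP hP'
  obtain ⟨rfl, rfl⟩ := (mem_strata_iff H).1 hP
  obtain ⟨rfl, rfl⟩ := (mem_strata_iff H).1 hP'
  exact hne rfl

end SplittingSpace

/-! ## The lattice `Λ_m` -/

section LatticeGenerators

variable {B F : Type u} [CommRing B] [Field F] [Algebra B F] {π : B} {m : ℕ}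

lemma splitHermitian_single {F₀ : Type u} [Field F₀] [Algebra F₀ F] (σ : F ≃ₐ[F₀] F) {n : ℕ}
    (x : Fin n → F) (j : Fin n) (v : F) :
    splitHermitian σ x (Pi.single (Fin.rev j) v) = σ (x j) * v := by
  rw [splitHermitian, Finset.sum_eq_single j]
  · simp
  · intro i _ hi
    rw [Pi.single_eq_of_ne (fun h => hi (Fin.rev_injective h)), mul_zero]
  · simp

/-- The coefficient of the `j`-th generator of `Λ_m`. -/
noncomputable def latticeCoeff (F : Type u) [Field F] [Algebra B F] (π : B) (m : ℕ) (j : Fin (2 * m)) : F :=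
  if (j : ℕ) < m then (algebraMap B F π)⁻¹ else 1

lemma single_mem_stdLattice {m : ℕ} (j : Fin (2 * m)) (c : B) :
    Pi.single j (algebraMap B F c * latticeCoeff F π m j) ∈ stdLattice F π (2 * m) m := by
  have h : (Pi.single j (latticeCoeff F π m j) : Fin (2 * m) → F) ∈
      stdLattice F π (2 * m) m := by
    refine Submodule.subset_span ⟨j, ?_⟩
    by_cases hj : (j : ℕ) < m
    · simp [hj, latticeCoeff, ← Pi.single_smul]
    · simp [hj, latticeCoeff]
  have h' := Submodule.smul_mem _ c h
  rwa [← Pi.single_smul, Algebra.smul_def] at h'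

/-- The standard generators of `Λ_m` and their multiples by `π`. -/
noncomputable def latticeVec (F : Type u) [Field F] [Algebra B F] (π : B) (m : ℕ)
    (j : Fin (2 * m) × Fin 2) : stdLattice F π (2 * m) m :=
  ⟨_, single_mem_stdLattice j.1 (π ^ (j.2 : ℕ))⟩

lemma dual_mem_stdLattice (hπ : algebraMap B F π ≠ 0) (m : ℕ) (j : Fin (2 * m) × Fin 2) :
    Pi.single (Fin.rev j.1) (if (j.1 : ℕ) < m then
      (if j.2 = 0 then -algebraMap B F π else 1)
      else (if j.2 = 0 then 1 else -(algebraMap B F π)⁻¹)) ∈ stdLattice F π (2 * m) m := by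
  obtain ⟨j, e⟩ := j
  by_cases hj : (j : ℕ) < m
  · have hr : ¬ ((Fin.rev j : Fin (2 * m)) : ℕ) < m := by rw [Fin.val_rev]; omega
    have h := single_mem_stdLattice (F := F) (π := π) (Fin.rev j) (if e = 0 then -π else 1)
    rw [latticeCoeff, if_neg hr, mul_one] at h
    convert h using 2
    simp only [hj, if_true]
    split_ifs <;> simp
  · have hr : ((Fin.rev j : Fin (2 * m)) : ℕ) < m := by rw [Fin.val_rev]; omega
    have h := single_mem_stdLattice (F := F) (π := π) (Fin.rev j) (if e = 0 then π else -1)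
    rw [latticeCoeff, if_pos hr] at h
    convert h using 2
    simp only [hj, if_false]
    split_ifs <;> simp [hπ]

lemma latticeVec_apply (i : Fin (2 * m) × Fin 2) (j : Fin (2 * m)) :
    (latticeVec F π m i : Fin (2 * m) → F) j =
      if i.1 = j then algebraMap B F π ^ (i.2 : ℕ) * latticeCoeff F π m j else 0 := by
  by_cases h : i.1 = j
  · subst h
    simp [latticeVec]
  · rw [if_neg h]
    simp [latticeVec, Pi.single_eq_of_ne (Ne.symm h)]

lemma latticeT_apply (A : Type u) [CommRing A] [Algebra A F] [Algebra A B]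
    [IsScalarTower A B F] (x : stdLattice F π (2 * m) m) (j : Fin (2 * m)) :
    (latticeT A π m x : Fin (2 * m) → F) j = algebraMap B F π * (x : Fin (2 * m) → F) j := by
  rw [← Algebra.smul_def]
  rfl

lemma latticeT_latticeVec (A : Type u) [CommRing A] [Algebra A F] [Algebra A B]
    [IsScalarTower A B F] (j : Fin (2 * m)) :
    latticeT A π m (latticeVec F π m (j, 0)) = latticeVec F π m (j, 1) := by
  apply Subtype.ext
  ext i
  rw [latticeT_apply, latticeVec_apply, latticeVec_apply]
  by_cases h : j = i <;> simp [h]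

end LatticeGenerators

/-! ### Perfectness of the pairing on the lattice and the contracting homotopy. -/

section RamifiedLattice

variable {A B F₀ F : Type u} [CommRing A] [IsDomain A]
    [IsDiscreteValuationRing A] [CommRing B] [Field F₀] [Field F]
    [Algebra A F₀] [IsFractionRing A F₀] [Algebra F₀ F] [Algebra A F] [IsScalarTower A F₀ F]
    [Algebra A B] [Algebra B F] [IsScalarTower A B F] [IsIntegralClosure B A F]
    {σ : F ≃ₐ[F₀] F} {π₀ : A} {π : B}

namespace IsRamifiedQuadratic

variable (D : IsRamifiedQuadratic A B F₀ F σ π₀ π)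
include D

lemma isUnit_two : IsUnit (2 : A) := by
  rw [← IsLocalRing.residue_ne_zero_iff_isUnit, map_ofNat]
  exact Ring.two_ne_zero D.residue_char

lemma two_ne_zero : (2 : F) ≠ 0 := by
  have := (D.isUnit_two.map (algebraMap A F)).ne_zero
  rwa [map_ofNat] at this

lemma finiteDimensional : FiniteDimensional F₀ F :=
  .of_finrank_pos (by rw [D.finrank_eq]; norm_num)

lemma card_aut : Nat.card (F ≃ₐ[F₀] F) = 2 := by
  have := D.finiteDimensional
  rw [Nat.card_eq_fintype_card]
  refine le_antisymm ?_ ?_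
  · exact (AlgEquiv.card_le (F := F₀) (K := F)).trans_eq D.finrank_eq
  · exact Fintype.one_lt_card_iff.2 ⟨σ, 1, D.conj_ne_one⟩

lemma isGalois : IsGalois F₀ F := by
  have := D.finiteDimensional
  exact IsGalois.of_card_aut_eq_finrank _ _ (by rw [D.card_aut, D.finrank_eq])

lemma eq_one_or_eq (τ : F ≃ₐ[F₀] F) : τ = 1 ∨ τ = σ := by
  classical
  have := D.finiteDimensional
  have h : ({1, σ} : Finset (F ≃ₐ[F₀] F)) = Finset.univ := by
    apply Finset.eq_univ_of_card
    rw [Finset.card_pair D.conj_ne_one.symm, ← Nat.card_eq_fintype_card, D.card_aut]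
  have hm := Finset.mem_univ τ
  rw [← h] at hm
  simpa using hm

lemma conj_conj (x : F) : σ (σ x) = x := by
  rcases D.eq_one_or_eq (σ * σ) with h | h
  · exact congrArg (fun τ : F ≃ₐ[F₀] F => τ x) h
  · exact absurd (mul_eq_left.1 h) D.conj_ne_one

lemma algebraMap_trace (x : F) : algebraMap F₀ F (Algebra.trace F₀ F x) = x + σ x := by
  classical
  have := D.finiteDimensional
  have := D.isGalois
  rw [trace_eq_sum_automorphisms]
  have : (Finset.univ : Finset (F ≃ₐ[F₀] F)) = {1, σ} := by
    ext τ
    simpa using D.eq_one_or_eq τ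
  rw [this, Finset.sum_pair D.conj_ne_one.symm]
  rfl

lemma uniformizer_ne_zero : algebraMap B F π ≠ 0 := fun h0 =>
  D.irreducible.ne_zero (IsIntegralClosure.algebraMap_injective B A F (by simpa using h0))

lemma uniformizer_sq : (algebraMap B F π) ^ 2 = algebraMap A F π₀ := by
  rw [← map_pow, D.sq_eq, ← IsScalarTower.algebraMap_apply]

/-- If `π` were fixed by `σ` it would lie in `F₀`, hence in `A` by integrality, and the irreducible
`π₀` would be a square in `A`. -/
lemma conj_uniformizer : σ (algebraMap B F π) = -algebraMap B F π := by
  have hσ : σ (algebraMap B F π) = algebraMap B F π ∨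
      σ (algebraMap B F π) = -algebraMap B F π := by
    rw [← sq_eq_sq_iff_eq_or_eq_neg, ← map_pow, D.uniformizer_sq,
      IsScalarTower.algebraMap_apply A F₀ F, σ.commutes]
  refine hσ.resolve_left fun h => ?_
  have := D.finiteDimensional
  have := D.isGalois
  obtain ⟨x, hx⟩ := (IsGalois.mem_range_algebraMap_iff_fixed (F := F₀) (algebraMap B F π)).2
    fun τ => by
      rcases D.eq_one_or_eq τ with rfl | rfl
      · rfl
      · exact h
  have hint : IsIntegral A x := by
    rw [← isIntegral_algebraMap_iff (algebraMap F₀ F).injective (R := A), hx]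
    exact (IsIntegralClosure.isIntegral_iff (R := A) (A := B) (B := F)).2 ⟨π, rfl⟩
  obtain ⟨a, rfl⟩ := (IsIntegrallyClosed.isIntegral_iff (R := A) (K := F₀)).1 hint
  have ha : a * a = π₀ := by
    have hinj : Function.Injective (algebraMap A F) := by
      rw [IsScalarTower.algebraMap_eq A F₀ F]
      exact (algebraMap F₀ F).injective.comp (IsFractionRing.injective A F₀)
    apply hinj
    rw [← D.uniformizer_sq, ← hx, map_mul, ← IsScalarTower.algebraMap_apply, sq]
  have hu := (D.irreducible_base.isUnit_or_isUnit ha.symm)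
  have hu' : IsUnit a := hu.elim id id
  exact D.irreducible_base.not_isUnit (ha ▸ hu'.mul hu')

lemma algebraMap_latticeForm (m : ℕ) (x y : stdLattice F π (2 * m) m) :
    algebraMap A F (latticeForm D m x y) =
      (splitHermitian σ (x : Fin (2 * m) → F) y + σ (splitHermitian σ (x : Fin (2 * m) → F) y)) / 2 := by
  have h : algebraMap A F₀ (latticeForm D m x y) = traceForm σ (2 * m) x y :=
    LinearMap.restrictScalarsRange₂_apply
      ((stdLattice F π (2 * m) m).subtype.restrictScalars A)
      ((stdLattice F π (2 * m) m).subtype.restrictScalars A)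
      (Algebra.linearMap A F₀) (IsFractionRing.injective A F₀) (traceForm σ (2 * m))
      (fun x y => exists_algebraMap_traceForm D m x.2 y.2) x y
  rw [IsScalarTower.algebraMap_apply A F₀ F, h]
  simp only [traceForm, LinearMap.mk₂_apply, map_mul, D.algebraMap_trace, map_div₀, map_one,
    map_ofNat]
  ring

lemma latticeForm_ext {m : ℕ} {a : A} {x y : stdLattice F π (2 * m) m}
    (h : algebraMap A F (latticeForm D m x y) = algebraMap A F a) : latticeForm D m x y = a := by
  have hinj : Function.Injective (algebraMap A F) := by
    rw [IsScalarTower.algebraMap_eq A F₀ F]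
    exact (algebraMap F₀ F).injective.comp (IsFractionRing.injective A F₀)
  exact hinj h

lemma splitHermitian_symm {n : ℕ} (x y : Fin n → F) :
    splitHermitian σ y x = σ (splitHermitian σ x y) := by
  simp only [splitHermitian, map_sum, map_mul, D.conj_conj]
  rw [← Equiv.sum_comp Fin.revPerm]
  exact Finset.sum_congr rfl fun i _ => by simp [mul_comm]

end IsRamifiedQuadratic

variable (D : IsRamifiedQuadratic A B F₀ F σ π₀ π) (m : ℕ)

/-- The family in `Λ_m` dual to `latticeVec`. -/
noncomputable def latticeDual (j : Fin (2 * m) × Fin 2) : stdLattice F π (2 * m) m :=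
  ⟨_, dual_mem_stdLattice D.uniformizer_ne_zero m j⟩

/-- Writing the `j`-th coordinate of `x` relative to its generator as `α + β π` with `α, β ∈ F₀`,
the dual vector `(j, 0)` extracts `α` and `(j, 1)` extracts `β`. The coefficients in
`dual_mem_stdLattice` are chosen for this. -/
lemma latticeForm_latticeDual_zero (x : stdLattice F π (2 * m) m) (j : Fin (2 * m)) :
    algebraMap A F (latticeForm D m x (latticeDual D m (j, 0))) =
      ((x : Fin (2 * m) → F) j * (latticeCoeff F π m j)⁻¹ +
        σ ((x : Fin (2 * m) → F) j * (latticeCoeff F π m j)⁻¹)) / 2 := by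
  rw [D.algebraMap_latticeForm]
  simp only [latticeDual, splitHermitian_single]
  by_cases hj : (j : ℕ) < m
  · simp only [hj, if_true, latticeCoeff, inv_inv, map_mul, map_neg, D.conj_conj,
      D.conj_uniformizer]
    ring
  · simp only [hj, if_false, if_true, latticeCoeff, inv_one, map_mul, map_one, D.conj_conj]
    ring

lemma latticeForm_latticeDual_one (x : stdLattice F π (2 * m) m) (j : Fin (2 * m)) :
    algebraMap A F (latticeForm D m x (latticeDual D m (j, 1))) =
      ((x : Fin (2 * m) → F) j * (latticeCoeff F π m j)⁻¹ -
        σ ((x : Fin (2 * m) → F) j * (latticeCoeff F π m j)⁻¹)) / (2 * algebraMap B F π) := by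
  have h2 := D.two_ne_zero
  have hπ := D.uniformizer_ne_zero
  rw [D.algebraMap_latticeForm]
  simp only [latticeDual, splitHermitian_single]
  by_cases hj : (j : ℕ) < m
  · simp only [hj, if_true, latticeCoeff, inv_inv, map_mul, D.conj_conj, map_one,
      D.conj_uniformizer, one_ne_zero, if_false]
    field_simp
    ring
  · simp only [hj, if_false, latticeCoeff, inv_one, map_mul, map_one, D.conj_conj, map_neg, map_inv₀,
      D.conj_uniformizer, one_ne_zero]
    field_simp
    ring

include D in
lemma latticeCoeff_ne_zero (j : Fin (2 * m)) : latticeCoeff F π m j ≠ 0 := by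
  have hπ := D.uniformizer_ne_zero
  unfold latticeCoeff
  split_ifs
  · exact inv_ne_zero hπ
  · exact one_ne_zero

lemma latticeForm_latticeVec (i k : Fin (2 * m) × Fin 2) :
    latticeForm D m (latticeVec F π m i) (latticeDual D m k) = if i = k then 1 else 0 := by
  have h2 := D.two_ne_zero
  have hπ := D.uniformizer_ne_zero
  have hd := latticeCoeff_ne_zero D m
  apply D.latticeForm_ext
  obtain ⟨i, e⟩ := i
  obtain ⟨k, f⟩ := k
  by_cases hik : i = k
  · subst hik
    fin_cases e <;> fin_cases f <;>
      simp [latticeForm_latticeDual_zero, latticeForm_latticeDual_one, latticeVec_apply,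
        D.conj_uniformizer, hd]
    · norm_num [h2]
    · field_simp
      ring
  · fin_cases f <;>
      simp [latticeForm_latticeDual_zero, latticeForm_latticeDual_one, latticeVec_apply, hik]

/-- This is `y = (y + σ y)/2 + π (y - σ y)/(2π)` in each coordinate. The coefficients lie in `A`
because the pairing does, so `O_F = O_{F₀} ⊕ π O_{F₀}` need not be proved separately. -/
lemma sum_latticeForm_smul (x : stdLattice F π (2 * m) m) :
    ∑ k, latticeForm D m x (latticeDual D m k) • latticeVec F π m k = x := by
  have h2 := D.two_ne_zero
  have hπ := D.uniformizer_ne_zero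
  have hd := latticeCoeff_ne_zero D m
  have hs : ∀ (a : A) (y : stdLattice F π (2 * m) m) (j : Fin (2 * m)),
      ((a • y : stdLattice F π (2 * m) m) : Fin (2 * m) → F) j =
        algebraMap A F a * (y : Fin (2 * m) → F) j := by
    intro a y j
    rw [← Algebra.smul_def]
    rfl
  apply Subtype.ext
  ext j
  rw [Submodule.coe_sum, Finset.sum_apply, Fintype.sum_prod_type, Finset.sum_eq_single j]
  · rw [Fin.sum_univ_two, hs, hs, latticeForm_latticeDual_zero, latticeForm_latticeDual_one,
      latticeVec_apply, latticeVec_apply]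
    have := hd j
    simp only [if_true, Fin.val_zero, pow_zero, one_mul, Fin.val_one, pow_one]
    field_simp
    ring
  · intro i _ hi
    simp [hs, latticeVec_apply, hi]
  · simp

/-- `latticeVec` as a basis. -/
noncomputable def latticeBasis :
    Module.Basis (Fin (2 * m) × Fin 2) A (stdLattice F π (2 * m) m) :=
  Module.Basis.ofEquivFun
    { toFun := fun x k => latticeForm D m x (latticeDual D m k)
      invFun := fun a => ∑ k, a k • latticeVec F π m k
      map_add' := fun x y => by ext k; simp
      map_smul' := fun a x => by ext k; simp
      left_inv := sum_latticeForm_smul D m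
      right_inv := fun a => by
        ext k
        simp [latticeForm_latticeVec] }

lemma latticeBasis_apply (k : Fin (2 * m) × Fin 2) : latticeBasis D m k = latticeVec F π m k := by
  simp [latticeBasis, Pi.single_apply]

include D in
lemma latticeT_latticeT (x : stdLattice F π (2 * m) m) :
    latticeT A π m (latticeT A π m x) = π₀ • x := by
  apply Subtype.ext
  ext i
  rw [latticeT_apply, latticeT_apply, ← mul_assoc, ← sq, D.uniformizer_sq, ← Algebra.smul_def]
  rfl

/-- The lattice `Λ_m` with its pairing and the multiplication by `π`. -/
theorem isDualLattice_latticeForm :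
    IsDualLattice (latticeT A π m) (latticeForm D m) π₀ (2 * (2 * m)) where
  symm x y := by
    apply D.latticeForm_ext
    have h : splitHermitian σ (y : Fin (2 * m) → F) x = σ (splitHermitian σ (x : Fin (2 * m) → F) y) :=
      D.splitHermitian_symm _ _
    rw [D.algebraMap_latticeForm, D.algebraMap_latticeForm, h, D.conj_conj, add_comm]
  skew x y := by
    apply D.latticeForm_ext
    rw [map_neg, D.algebraMap_latticeForm, D.algebraMap_latticeForm]
    have h : splitHermitian σ (latticeT A π m x : Fin (2 * m) → F) y =
        -splitHermitian σ (x : Fin (2 * m) → F) (latticeT A π m y) := by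
      simp only [splitHermitian, latticeT_apply, ← Finset.sum_neg_distrib, map_mul,
        D.conj_uniformizer]
      exact Finset.sum_congr rfl fun i _ => by ring
    rw [h, map_neg]
    ring
  sq := latticeT_latticeT D m
  homotopy := by
    -- The homotopy divides the generators `(k, 1)` by `π` and kills the generators `(k, 0)`.
    refine ⟨(latticeBasis D m).constr A fun k =>
      if k.2 = 1 then latticeVec F π m (k.1, 0) else 0, fun x => ?_⟩
    have h0 : ∀ k, (latticeBasis D m).constr A (fun k =>
        if k.2 = 1 then latticeVec F π m (k.1, 0) else 0) (latticeVec F π m k) =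
          if k.2 = 1 then latticeVec F π m (k.1, 0) else 0 := fun k => by
      rw [← latticeBasis_apply D, Module.Basis.constr_basis]
    set j := (latticeBasis D m).constr A (fun k =>
      if k.2 = 1 then latticeVec F π m (k.1, 0) else 0)
    have : latticeT A π m ∘ₗ j + j ∘ₗ latticeT A π m = LinearMap.id := by
      refine (latticeBasis D m).ext fun ⟨k, e⟩ => ?_
      rw [latticeBasis_apply]
      simp only [LinearMap.add_apply, LinearMap.comp_apply, LinearMap.id_apply]
      fin_cases e
      · simp [h0, latticeT_latticeVec]
      · have h1 : latticeT A π m (latticeVec F π m (k, 1)) = π₀ • latticeVec F π m (k, 0) := by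
          rw [← latticeT_latticeVec A, latticeT_latticeT D]
        simp [h0, h1, latticeT_latticeVec]
    exact LinearMap.congr_fun this x
  dual := by
    let e : Fin (2 * m) × Fin 2 ≃ Fin (2 * (2 * m)) :=
      finProdFinEquiv.trans (finCongr (mul_comm _ _))
    refine ⟨(latticeBasis D m).reindex e, fun k => latticeDual D m (e.symm k), fun i k => ?_⟩
    rw [Module.Basis.reindex_apply, latticeBasis_apply, latticeForm_latticeVec]
    simp

end RamifiedLattice

/-! ### The closure relations for the splitting model. -/

theorem mainTheorem3 {A B F₀ F : Type u} [CommRing A] [IsDomain A]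
    [IsDiscreteValuationRing A] [IsAdicComplete (IsLocalRing.maximalIdeal A) A]
    [PerfectField (IsLocalRing.ResidueField A)]
    [CommRing B] [Field F₀] [Field F]
    [Algebra A F₀] [IsFractionRing A F₀] [Algebra F₀ F] [Algebra A F] [IsScalarTower A F₀ F]
    [Algebra A B] [Algebra B F] [IsScalarTower A B F] [IsIntegralClosure B A F]
    {σ : F ≃ₐ[F₀] F} {π₀ : A} {π : B} (D : IsRamifiedQuadratic A B F₀ F σ π₀ π)
    (m r s : ℕ) (hn : 3 < 2 * m) (hrs : r + s = 2 * m) (hsr : s ≤ r)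
    (h l : ℕ) (hhl : h ≤ l) (hls : l ≤ s) (hh : h ≡ s [MOD 2]) (hl : l ≡ s [MOD 2]) :
    closure (stratum D m r s h l) =
        (⋃ q ∈ {q : ℕ × ℕ | q.1 ≤ h ∧ l ≤ q.2 ∧ q.2 ≤ s ∧ q.1 ≡ s [MOD 2] ∧ q.2 ≡ s [MOD 2]},
          stratum D m r s q.1 q.2) ∧
      {q : ℕ × ℕ | q.1 ≤ h ∧ l ≤ q.2 ∧ q.2 ≤ s ∧ q.1 ≡ s [MOD 2] ∧ q.2 ≡ s [MOD 2]}.PairwiseDisjoint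
        fun q => stratum D m r s q.1 q.2 := by
  -- Over `B` the scalar `π₀` becomes `π ^ 2`, so it vanishes wherever `π` does.
  have H : IsDualLattice ((latticeT A π m).baseChange B) ((latticeForm D m).baseChange B) (π ^ 2)
      (2 * (2 * m)) := by
    rw [D.sq_eq]
    exact (isDualLattice_latticeForm D m).baseChange B
  have h2 : IsUnit (2 : B) := by
    have h := D.isUnit_two.map (algebraMap A B)
    rwa [map_ofNat] at h
  exact ⟨SplittingSpace.closure_strata H hrs h2 hhl hls hh hl,
    fun q _ q' _ hne => SplittingSpace.disjoint_strata H hne⟩
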